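/- Let $d\ge 2$, $0<\lambda\le\Lambda<\infty$ and $\alpha\in(0,1]$, and let $\beta\in(0,\alpha]$ with $\beta<1$ (so that $\beta=\alpha$ is allowed whenever $\alpha<1$). Write $B_s$ for the open ball of radius $s$ centred at the origin of $\mathbb{R}^d$, $[f]_{C^{0,\gamma}(U)}:=\sup_{x,y\in U,\,x\ne y}\frac{|f(x)-f(y)|}{|x-y|^\gamma}$ (with the Frobenius norm for matrix-valued $f$), and $\|f\|_{\underline{L}^1(U)}:=\frac1{|U|}\int_U|f|$. There exists a constant $C\in[1,\infty)$, depending only on $(\alpha,\beta,d,\lambda,\Lambda)$, such that the following holds for every $r>0$. Let $\mathbf{A}=(\mathbf{A}_{ij})$ belong to $C^{0,\alpha}(B_{2r})$, with values in the symmetric $d\times d$ matrices, and satisfy $\lambda I_d\le \mathbf{A}(x)\le\Lambda I_d$ for all $x\in B_{2r}$. Let $m\in L^1(B_{2r})$ be a (real-valued, not necessarily nonnegative) weak solution of $-\sum_{i,j=1}^d\partial_i\partial_j(\mathbf{A}_{ij}m)=0$ in $B_{2r}$, that is, $$-\int_{B_{2r}}\sum_{i,j=1}^d\mathbf{A}_{ij}(x)\,\partial_i\partial_j\varphi(x)\,m(x)\,dx=0\qquad\text{for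 all }\varphi\in C_c^\infty(B_{2r}).$$ Then, after modification on a null set, $m\in C^{0,\beta}(B_r)$, and $$\|m\|_{L^\infty(B_r)}+r^\beta[m]_{C^{0,\beta}(B_r)}\le C\bigl(1+r^\alpha[\mathbf{A}]_{C^{0,\alpha}(B_{2r})}\bigr)^{(d+\beta)/\alpha}\,\|m\|_{\underline{L}^1(B_{2r})}.$$ In particular, if $\alpha<1$, then $m\in C^{0,\alpha}(B_r)$, with this bound for $\beta=\alpha$. -/

import Mathlib

open MeasureTheory Set
open scoped ENNReal Matrix.Norms.Frobenius

noncomputable section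

/-- The Euclidean space `ℝ^d`. -/
abbrev Euc (d : ℕ) : Type := EuclideanSpace ℝ (Fin d)

/-- The Hölder seminorm `sup { |f x - f y| / |x - y| ^ α : x, y ∈ U, x ≠ y }`, with values in
`[0, ∞]`. -/
def holderSeminorm {E F : Type*} [NormedAddCommGroup E] [NormedAddCommGroup F]
    (α : ℝ) (U : Set E) (f : E → F) : ℝ≥0∞ :=
  ⨆ x ∈ U, ⨆ y ∈ U, ⨆ _ : x ≠ y, ‖f x - f y‖ₑ / ‖x - y‖ₑ ^ α

/-- Membership in `C^{0,α}(U)`: the function is bounded on `U` and its Hölder seminorm on `U` is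
finite. -/
def MemHolderSpace {E F : Type*} [NormedAddCommGroup E] [NormedAddCommGroup F]
    (α : ℝ) (U : Set E) (f : E → F) : Prop :=
  (⨆ x ∈ U, ‖f x‖ₑ) < ⊤ ∧ holderSeminorm α U f < ⊤

/-- The values of `A` on `U` are symmetric matrices with `lam I ≤ A x ≤ Lam I`. -/
def IsUniformlyElliptic {d : ℕ} (lam Lam : ℝ) (U : Set (Euc d))
    (A : Euc d → Matrix (Fin d) (Fin d) ℝ) : Prop :=
  ∀ x ∈ U, (A x).IsSymm ∧ ∀ ξ : Fin d → ℝ,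
    lam * (ξ ⬝ᵥ ξ) ≤ ξ ⬝ᵥ (A x).mulVec ξ ∧ ξ ⬝ᵥ (A x).mulVec ξ ≤ Lam * (ξ ⬝ᵥ ξ)

/-- The second partial derivative `∂_i ∂_j φ (x)`. -/
def partialTwo {d : ℕ} (φ : Euc d → ℝ) (i j : Fin d) (x : Euc d) : ℝ :=
  fderiv ℝ (fun y => fderiv ℝ φ y (EuclideanSpace.single j 1)) x (EuclideanSpace.single i 1)

/-- `m` is a weak solution in `U` of the adjoint (doubly divergence form) equation
`- ∑ i j, ∂_i ∂_j (A_ij m) = 0`: it is locally integrable in `U`, and the equation holds when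
tested against every smooth function with compact support in `U`. -/
def IsAdjointWeakSolution {d : ℕ} (A : Euc d → Matrix (Fin d) (Fin d) ℝ) (U : Set (Euc d))
    (m : Euc d → ℝ) : Prop :=
  LocallyIntegrableOn m U ∧
    ∀ φ : Euc d → ℝ, ContDiff ℝ (⊤ : ℕ∞) φ → HasCompactSupport φ → tsupport φ ⊆ U →
      -∫ x in U, (∑ i, ∑ j, A x i j * partialTwo φ i j x) * m x = 0

end

open Filter Topology Metric

/-! Freeze the coefficients at a point `p`, put `B = A(p)⁻¹` and `q(w) = w · B w`, and let `h` be a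
smooth cutoff with primitive `H`, `H' = h / 2`. The test function `y ↦ H(q((y - x) / t))` has
compact support, and `A(p)` contracted with its Hessian is `t⁻² (d h + 2 q h')`, taken at `q((y - x)
/ t)`. Up to the factor `-t^(1 - d)` this is the derivative in `t` of the rescaled kernel `t^(-d)
h(q((y - x) / t))`. Testing the equation therefore controls how the mean of `m` against this kernel
depends on the scale: its `t`-derivative contains only `A(p) - A(y)`, so passing from `t` to `t / 2`
costs the oscillation of `A` at scale `t` times a mean of `|m|` (`abs_localMean_sub_le`). No
derivative of `A` or `m` appears, and the sign of `m` plays no role.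

Local boundedness. With `p = x` the means converge, at Lebesgue points, to `m x` times the mass of
the kernel. Summing over dyadic scales bounds `|m x|` by `D(x)^(-d) ‖m‖₁`, where `D` is a truncated
distance to the boundary, plus `ε` times a dyadic potential `∑ κ^k (mean of |m| at scale D(x)
2^(-k))` with `κ = 2^(-β) < 1`. This potential is bounded on `L¹`. For small `ε` the part of `|m|`
exceeding twice the first term has an integral at most half of itself, so it vanishes
(`ae_le_of_le_dyadicPotential`).

Hölder continuity. Once `m` is bounded, the means converge at the rate `κ^k`. To compare `x` and
`x'` at distance about `2^(-k)`, stop at scale `k`, move the centre with the matrix fixed, then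
change the matrix. Moving the centre is again telescoped over scales; scale `j` gains a factor `2^(j
- k)`, and `∑ κ^j 2^(j - k)` is of order `κ^k` exactly because `β < 1`. Dividing by the mass of the
kernel, itself Hölder in `x`, gives the continuous version of `m`.

Scaling. All this is applied at a scale `ρ` comparable to `r (1 + r^α [A])^(-1/α)`, where the
oscillation is small. The losses `(r / ρ)^d` and `(r / ρ)^β` produce the exponent `(d + β) / α`. -/

section

/-! ### The one-variable cutoff and its primitive -/

/-- A smooth function on the line, equal to `1` on `(-∞, 1]` and to `0` on `[2, ∞)`. -/
noncomputable def cutoff (s : ℝ) : ℝ := Real.smoothTransition (2 - s)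

/-- The primitive of `cutoff / 2` that vanishes on `[2, ∞)`. -/
noncomputable def cutoffPrim (s : ℝ) : ℝ := ∫ x in (2 : ℝ)..s, cutoff x / 2

lemma cutoff_contDiff : ContDiff ℝ (⊤ : ℕ∞) cutoff :=
  Real.smoothTransition.contDiff.comp (contDiff_const.sub contDiff_id)

lemma cutoff_nonneg (s : ℝ) : 0 ≤ cutoff s := Real.smoothTransition.nonneg _

lemma cutoff_le_one (s : ℝ) : cutoff s ≤ 1 := Real.smoothTransition.le_one _

lemma abs_cutoff_le_one (s : ℝ) : |cutoff s| ≤ 1 := by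
  rw [abs_of_nonneg (cutoff_nonneg s)]; exact cutoff_le_one s

lemma cutoff_of_le {s : ℝ} (h : s ≤ 1) : cutoff s = 1 :=
  Real.smoothTransition.one_of_one_le (by linarith)

lemma cutoff_of_ge {s : ℝ} (h : 2 ≤ s) : cutoff s = 0 :=
  Real.smoothTransition.zero_of_nonpos (by linarith)

lemma cutoff_continuous : Continuous cutoff := cutoff_contDiff.continuous

lemma hasDerivAt_cutoff (s : ℝ) : HasDerivAt cutoff (deriv cutoff s) s :=
  (cutoff_contDiff.differentiable (by simp) s).hasDerivAt

lemma deriv_cutoff_contDiff : ContDiff ℝ (⊤ : ℕ∞) (deriv cutoff) :=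
  (contDiff_infty_iff_deriv.1 cutoff_contDiff).2

lemma deriv_cutoff_continuous : Continuous (deriv cutoff) := deriv_cutoff_contDiff.continuous

/-- At the endpoint `s = 2` only the right-hand derivative is known to vanish; since `cutoff` is
differentiable there, it determines the derivative. -/
lemma deriv_cutoff_of_ge {s : ℝ} (h : 2 ≤ s) : deriv cutoff s = 0 := by
  have h1 : HasDerivWithinAt cutoff (deriv cutoff s) (Ici s) s :=
    (hasDerivAt_cutoff s).hasDerivWithinAt
  have h2 : HasDerivWithinAt cutoff 0 (Ici s) s :=
    (hasDerivWithinAt_const s (Ici s) (0 : ℝ)).congr (fun y hy => cutoff_of_ge (h.trans hy))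
      (cutoff_of_ge h)
  exact (uniqueDiffWithinAt_Ici s).eq_deriv _ h1 h2

lemma hasDerivAt_cutoffPrim (s : ℝ) : HasDerivAt cutoffPrim (cutoff s / 2) s := by
  have hc : Continuous fun x => cutoff x / 2 := cutoff_continuous.div_const 2
  exact intervalIntegral.integral_hasDerivAt_right (hc.intervalIntegrable _ _)
    (hc.stronglyMeasurableAtFilter _ _) hc.continuousAt

lemma cutoffPrim_contDiff : ContDiff ℝ (⊤ : ℕ∞) cutoffPrim := by
  refine contDiff_infty_iff_deriv.2 ⟨fun s => (hasDerivAt_cutoffPrim s).differentiableAt, ?_⟩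
  have : deriv cutoffPrim = fun s => cutoff s / 2 := funext fun s => (hasDerivAt_cutoffPrim s).deriv
  rw [this]
  exact cutoff_contDiff.div_const 2

lemma cutoffPrim_of_ge {s : ℝ} (h : 2 ≤ s) : cutoffPrim s = 0 := by
  rw [cutoffPrim, intervalIntegral.integral_congr (g := fun _ => (0 : ℝ)),
    intervalIntegral.integral_zero]
  intro x hx
  rw [uIcc_of_le h] at hx
  simp [cutoff_of_ge hx.1]

/-! ### Quadratic forms and the Hessian of the test functions -/

variable {d : ℕ}

/-- The quadratic form with coefficients `B`. -/
def quadForm (B : Fin d → Fin d → ℝ) (w : Euc d) : ℝ := ∑ i, ∑ j, B i j * w i * w j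

/-- The linear form `w ↦ (B w)_j`. -/
def linForm (B : Fin d → Fin d → ℝ) (w : Euc d) (j : Fin d) : ℝ := ∑ i, B j i * w i

/-- The `(i, j)` entry of the Hessian of `cutoffPrim (quadForm B w)` for symmetric `B`. -/
noncomputable def hessKernel (B : Fin d → Fin d → ℝ) (w : Euc d) (i j : Fin d) : ℝ :=
  cutoff (quadForm B w) * B i j
    + 2 * deriv cutoff (quadForm B w) * linForm B w i * linForm B w j

lemma contDiff_coord (i : Fin d) : ContDiff ℝ (⊤ : ℕ∞) fun w : Euc d => w i :=
  contDiff_euclidean.1 contDiff_id i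

lemma contDiff_entry (i j : Fin d) :
    ContDiff ℝ (⊤ : ℕ∞) fun p : (Fin d → Fin d → ℝ) × Euc d => p.1 i j :=
  (contDiff_apply_apply ℝ ℝ i j).comp contDiff_fst

lemma contDiff_quadForm_joint :
    ContDiff ℝ (⊤ : ℕ∞) fun p : (Fin d → Fin d → ℝ) × Euc d => quadForm p.1 p.2 := by
  unfold quadForm
  refine ContDiff.sum fun i _ => ContDiff.sum fun j _ => ?_
  have h1 := (contDiff_coord (d := d) i).comp
    (contDiff_snd : ContDiff ℝ (⊤ : ℕ∞) (Prod.snd : (Fin d → Fin d → ℝ) × Euc d → Euc d))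
  have h2 := (contDiff_coord (d := d) j).comp
    (contDiff_snd : ContDiff ℝ (⊤ : ℕ∞) (Prod.snd : (Fin d → Fin d → ℝ) × Euc d → Euc d))
  exact ((contDiff_entry i j).mul h1).mul h2

lemma contDiff_linForm_joint (j : Fin d) :
    ContDiff ℝ (⊤ : ℕ∞) fun p : (Fin d → Fin d → ℝ) × Euc d => linForm p.1 p.2 j := by
  unfold linForm
  refine ContDiff.sum fun i _ => ?_
  have h1 := (contDiff_coord (d := d) i).comp
    (contDiff_snd : ContDiff ℝ (⊤ : ℕ∞) (Prod.snd : (Fin d → Fin d → ℝ) × Euc d → Euc d))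
  exact (contDiff_entry j i).mul h1

lemma contDiff_hessKernel_joint (i j : Fin d) :
    ContDiff ℝ (⊤ : ℕ∞) fun p : (Fin d → Fin d → ℝ) × Euc d => hessKernel p.1 p.2 i j := by
  unfold hessKernel
  exact ((cutoff_contDiff.comp contDiff_quadForm_joint).mul (contDiff_entry i j)).add
    (((contDiff_const.mul (deriv_cutoff_contDiff.comp contDiff_quadForm_joint)).mul
      (contDiff_linForm_joint i)).mul (contDiff_linForm_joint j))

lemma contDiff_quadForm (B : Fin d → Fin d → ℝ) : ContDiff ℝ (⊤ : ℕ∞) (quadForm B) :=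
  contDiff_quadForm_joint.comp (contDiff_const.prodMk contDiff_id)

lemma contDiff_linForm (B : Fin d → Fin d → ℝ) (j : Fin d) :
    ContDiff ℝ (⊤ : ℕ∞) fun w => linForm B w j :=
  (contDiff_linForm_joint j).comp (contDiff_const.prodMk contDiff_id)

lemma contDiff_hessKernel (B : Fin d → Fin d → ℝ) (i j : Fin d) :
    ContDiff ℝ (⊤ : ℕ∞) fun w => hessKernel B w i j :=
  ContDiff.comp (g := fun p : (Fin d → Fin d → ℝ) × Euc d => hessKernel p.1 p.2 i j)
    (f := fun w => (B, w)) (contDiff_hessKernel_joint i j) (contDiff_const.prodMk contDiff_id)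

lemma quadForm_eq_sum_linForm (B : Fin d → Fin d → ℝ) (w : Euc d) :
    quadForm B w = ∑ i, w i * linForm B w i := by
  simp only [quadForm, linForm, Finset.mul_sum]
  exact Finset.sum_congr rfl fun i _ => Finset.sum_congr rfl fun j _ => by ring

lemma quadForm_smul (B : Fin d → Fin d → ℝ) (c : ℝ) (w : Euc d) :
    quadForm B (c • w) = c ^ 2 * quadForm B w := by
  simp only [quadForm, Finset.mul_sum, PiLp.smul_apply, smul_eq_mul]
  exact Finset.sum_congr rfl fun i _ => Finset.sum_congr rfl fun j _ => by ring

lemma linForm_add_smul_single (B : Fin d → Fin d → ℝ) (w : Euc d) (s : ℝ) (i j : Fin d) :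
    linForm B (w + s • EuclideanSpace.single i 1) j = linForm B w j + s * B j i := by
  simp [linForm, mul_add, Finset.sum_add_distrib, mul_comm]

lemma quadForm_add_smul_single {B : Fin d → Fin d → ℝ} (hB : ∀ i j, B i j = B j i) (w : Euc d)
    (s : ℝ) (i : Fin d) :
    quadForm B (w + s • EuclideanSpace.single i 1)
      = quadForm B w + 2 * s * linForm B w i + s ^ 2 * B i i := by
  rw [quadForm_eq_sum_linForm, quadForm_eq_sum_linForm]
  simp only [linForm_add_smul_single, PiLp.add_apply, PiLp.smul_apply, PiLp.single_apply,
    smul_eq_mul, add_mul, mul_add, Finset.sum_add_distrib]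
  have : ∑ x, w x * (s * B x i) = s * linForm B w i := by
    rw [linForm, Finset.mul_sum]
    exact Finset.sum_congr rfl fun x _ => by rw [hB x i]; ring
  rw [this]
  simp
  ring

lemma hasDerivAt_quadForm_line {B : Fin d → Fin d → ℝ} (hB : ∀ i j, B i j = B j i) (w : Euc d)
    (c : ℝ) (i : Fin d) :
    HasDerivAt (fun s : ℝ => quadForm B (w + (c * s) • EuclideanSpace.single i 1))
      (2 * c * linForm B w i) 0 := by
  simp only [quadForm_add_smul_single hB]
  have h : HasDerivAt (fun s : ℝ => c * s) c 0 := by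
    simpa using (hasDerivAt_id (0 : ℝ)).const_mul c
  have := (((h.const_mul 2).mul_const (linForm B w i)).const_add (quadForm B w)).add
    ((h.pow 2).mul_const (B i i))
  refine this.congr_deriv ?_
  simp

lemma hasDerivAt_linForm_line (B : Fin d → Fin d → ℝ) (w : Euc d)
    (c : ℝ) (i j : Fin d) :
    HasDerivAt (fun s : ℝ => linForm B (w + (c * s) • EuclideanSpace.single i 1) j)
      (c * B j i) 0 := by
  have h : HasDerivAt (fun s : ℝ => c * s) c 0 := by
    simpa using (hasDerivAt_id (0 : ℝ)).const_mul c
  simpa only [linForm_add_smul_single] using (h.mul_const (B j i)).const_add (linForm B w j)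

/-- Reduces the partial derivatives of the test functions to one-variable calculus along coordinate
lines, on which quadratic and linear forms are explicit polynomials. -/
lemma fderiv_apply_eq_of_hasDerivAt {f : Euc d → ℝ} {y v : Euc d} {f' : ℝ}
    (hf : DifferentiableAt ℝ f y) (h : HasDerivAt (fun s : ℝ => f (y + s • v)) f' 0) :
    fderiv ℝ f y v = f' := by
  rw [← hf.lineDeriv_eq_fderiv]
  exact HasLineDerivAt.lineDeriv h

/-- The test functions: rescaled translates of `cutoffPrim (quadForm B ·)`. -/
noncomputable def bump (B : Fin d → Fin d → ℝ) (x : Euc d) (t : ℝ) (y : Euc d) : ℝ :=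
  cutoffPrim (quadForm B (t⁻¹ • (y - x)))

lemma contDiff_rescale (x : Euc d) (t : ℝ) :
    ContDiff ℝ (⊤ : ℕ∞) fun y : Euc d => t⁻¹ • (y - x) :=
  (contDiff_id.sub contDiff_const).const_smul _

lemma contDiff_bump (B : Fin d → Fin d → ℝ) (x : Euc d) (t : ℝ) :
    ContDiff ℝ (⊤ : ℕ∞) (bump B x t) :=
  cutoffPrim_contDiff.comp ((contDiff_quadForm B).comp (contDiff_rescale x t))

lemma rescale_line (x y v : Euc d) (t s : ℝ) :
    t⁻¹ • (y + s • v - x) = t⁻¹ • (y - x) + (t⁻¹ * s) • v := by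
  rw [mul_smul, ← smul_add]; congr 1; abel

/-- The factor `1 / 2` in `cutoffPrim` cancels the `2` in the gradient `2 B w` of the quadratic
form. -/
lemma fderiv_bump_single {B : Fin d → Fin d → ℝ} (hB : ∀ i j, B i j = B j i) (x : Euc d) (t : ℝ)
    (y : Euc d) (j : Fin d) :
    fderiv ℝ (bump B x t) y (EuclideanSpace.single j 1)
      = t⁻¹ * (cutoff (quadForm B (t⁻¹ • (y - x))) * linForm B (t⁻¹ • (y - x)) j) := by
  refine fderiv_apply_eq_of_hasDerivAt ((contDiff_bump B x t).differentiable (by simp) y) ?_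
  simp only [bump, rescale_line]
  have h := hasDerivAt_quadForm_line hB (t⁻¹ • (y - x)) t⁻¹ j
  have := HasDerivAt.comp (0 : ℝ) (hasDerivAt_cutoffPrim _) h
  refine this.congr_deriv ?_
  simp
  ring

lemma partialTwo_bump {B : Fin d → Fin d → ℝ} (hB : ∀ i j, B i j = B j i) (x : Euc d) (t : ℝ)
    (i j : Fin d) (y : Euc d) :
    partialTwo (bump B x t) i j y = t⁻¹ ^ 2 * hessKernel B (t⁻¹ • (y - x)) i j := by
  rw [partialTwo]
  simp only [fderiv_bump_single hB]
  have hd : ContDiff ℝ (⊤ : ℕ∞) fun y : Euc d =>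
      t⁻¹ * (cutoff (quadForm B (t⁻¹ • (y - x))) * linForm B (t⁻¹ • (y - x)) j) :=
    contDiff_const.mul ((cutoff_contDiff.comp
      ((contDiff_quadForm B).comp (contDiff_rescale x t))).mul
      ((contDiff_linForm B j).comp (contDiff_rescale x t)))
  refine fderiv_apply_eq_of_hasDerivAt (hd.differentiable (by simp) y) ?_
  simp only [rescale_line]
  have h1 := HasDerivAt.comp (0 : ℝ) (hasDerivAt_cutoff _)
    (hasDerivAt_quadForm_line hB (t⁻¹ • (y - x)) t⁻¹ i)
  have h2 := hasDerivAt_linForm_line B (t⁻¹ • (y - x)) t⁻¹ i j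
  have := (h1.mul h2).const_mul t⁻¹
  refine this.congr_deriv ?_
  simp [hessKernel, hB j i]
  ring

/-- If `A B = 1`, then `A : D²(cutoffPrim ∘ quadForm B) = d h + 2 s h'` at `s = quadForm B w`. -/
lemma sum_mul_hessKernel {A B : Fin d → Fin d → ℝ} (hB : ∀ i j, B i j = B j i)
    (hAB : ∀ i k, ∑ j, A i j * B j k = if i = k then 1 else 0) (w : Euc d) :
    ∑ i, ∑ j, A i j * hessKernel B w i j
      = d * cutoff (quadForm B w) + 2 * quadForm B w * deriv cutoff (quadForm B w) := by
  have h1 : ∀ i, ∑ j, A i j * linForm B w j = w i := by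
    intro i
    simp only [linForm, Finset.mul_sum]
    rw [Finset.sum_comm]
    simp only [← mul_assoc, ← Finset.sum_mul, hAB]
    simp
  have h2 : ∀ i, ∑ j, A i j * hessKernel B w i j = cutoff (quadForm B w)
      + 2 * deriv cutoff (quadForm B w) * (w i * linForm B w i) := by
    intro i
    have h3 : ∑ j, A i j * B i j = 1 := by
      rw [← (by simpa using hAB i i : ∑ j, A i j * B j i = 1)]
      exact Finset.sum_congr rfl fun j _ => by rw [hB i j]
    calc _ = cutoff (quadForm B w) * ∑ j, A i j * B i j
          + 2 * deriv cutoff (quadForm B w) * linForm B w i * ∑ j, A i j * linForm B w j := by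
          rw [Finset.mul_sum, Finset.mul_sum, ← Finset.sum_add_distrib]
          exact Finset.sum_congr rfl fun j _ => by rw [hessKernel]; ring
      _ = _ := by rw [h3, h1]; ring
  simp only [h2, Finset.sum_add_distrib, ← Finset.mul_sum, ← quadForm_eq_sum_linForm]
  simp
  ring

/-! ### Elliptic matrices and their inverses -/

/-- A symmetric matrix with `lam I ≤ A ≤ Lam I`. -/
def IsEllipticMatrix (lam Lam : ℝ) (A : Matrix (Fin d) (Fin d) ℝ) : Prop :=
  A.IsSymm ∧ ∀ ξ : Fin d → ℝ,
    lam * (ξ ⬝ᵥ ξ) ≤ ξ ⬝ᵥ A.mulVec ξ ∧ ξ ⬝ᵥ A.mulVec ξ ≤ Lam * (ξ ⬝ᵥ ξ)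

/-- The entries of the inverse matrix, as a plain function. -/
noncomputable def invEntries (A : Matrix (Fin d) (Fin d) ℝ) : Fin d → Fin d → ℝ :=
  (A⁻¹ : Matrix (Fin d) (Fin d) ℝ)

namespace IsEllipticMatrix

variable {lam Lam : ℝ} {A A' : Matrix (Fin d) (Fin d) ℝ}

lemma isUnit_det (hA : IsEllipticMatrix lam Lam A) (hlam : 0 < lam) : IsUnit A.det := by
  rw [← Matrix.isUnit_iff_isUnit_det, ← Matrix.mulVec_injective_iff_isUnit]
  refine (injective_iff_map_eq_zero (Matrix.mulVecLin A)).2 fun ξ hξ => ?_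
  have h := (hA.2 ξ).1
  rw [show A.mulVec ξ = 0 from hξ, dotProduct_zero] at h
  have h0 : 0 ≤ ξ ⬝ᵥ ξ := by simpa using dotProduct_star_self_nonneg ξ
  have : ξ ⬝ᵥ ξ = 0 := by nlinarith
  exact dotProduct_self_eq_zero.1 this

lemma invEntries_comm (hA : IsEllipticMatrix lam Lam A) (i j : Fin d) :
    invEntries A i j = invEntries A j i := by
  have : (A⁻¹).transpose = A⁻¹ := by rw [Matrix.transpose_nonsing_inv, hA.1]
  exact congrFun (congrFun this j) i

lemma mulVec_inv_mulVec (hA : IsEllipticMatrix lam Lam A) (hlam : 0 < lam) (z : Fin d → ℝ) :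
    A.mulVec (A⁻¹.mulVec z) = z := by
  rw [Matrix.mulVec_mulVec, Matrix.mul_nonsing_inv _ (hA.isUnit_det hlam), Matrix.one_mulVec]

lemma sum_mul_invEntries (hA : IsEllipticMatrix lam Lam A) (hlam : 0 < lam) (i k : Fin d) :
    ∑ j, A i j * invEntries A j k = if i = k then 1 else 0 := by
  change ∑ j, A i j * A⁻¹ j k = _
  rw [← Matrix.mul_apply, Matrix.mul_nonsing_inv _ (hA.isUnit_det hlam), Matrix.one_apply]

/-- With `v = A⁻¹ z`, the first bound comes from expanding the form of `A` at `Lam v - z`, which is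
nonnegative, and bounding `z · A z` by `Lam |z|²`. The third is ellipticity at `v`, and the second
combines it with `|z - lam v|² ≥ 0`. No diagonalisation is needed. -/
lemma dotProduct_inv_bounds (hA : IsEllipticMatrix lam Lam A) (hlam : 0 < lam) (hLam : 0 < Lam)
    (z : Fin d → ℝ) :
    z ⬝ᵥ z ≤ Lam * (z ⬝ᵥ A⁻¹.mulVec z) ∧ lam * (z ⬝ᵥ A⁻¹.mulVec z) ≤ z ⬝ᵥ z ∧
      lam * (A⁻¹.mulVec z ⬝ᵥ A⁻¹.mulVec z) ≤ z ⬝ᵥ A⁻¹.mulVec z := by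
  set v := A⁻¹.mulVec z with hv
  have hAv : A.mulVec v = z := hA.mulVec_inv_mulVec hlam z
  have hvz : v ⬝ᵥ A.mulVec z = z ⬝ᵥ z := by
    rw [Matrix.dotProduct_mulVec, ← Matrix.mulVec_transpose, hA.1, hAv]
  have h1 := (hA.2 v).1
  rw [hAv, dotProduct_comm v z] at h1
  have h2 : 0 ≤ (z - lam • v) ⬝ᵥ (z - lam • v) := by
    simpa using dotProduct_star_self_nonneg (z - lam • v)
  have h3 := (hA.2 (Lam • v - z)).1
  have h4 : 0 ≤ (Lam • v - z) ⬝ᵥ (Lam • v - z) := by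
    simpa using dotProduct_star_self_nonneg (Lam • v - z)
  have h5 := (hA.2 z).2
  simp only [Matrix.mulVec_sub, Matrix.mulVec_smul, hAv, sub_dotProduct, dotProduct_sub,
    smul_dotProduct, dotProduct_smul, smul_eq_mul, hvz, dotProduct_comm v z] at h2 h3 h4
  refine ⟨?_, ?_, h1⟩
  · have h6 : 0 ≤ Lam * (Lam * (z ⬝ᵥ v) - z ⬝ᵥ z) := by nlinarith
    have := nonneg_of_mul_nonneg_right h6 hLam
    linarith
  · nlinarith

lemma quadForm_inv_eq (A : Matrix (Fin d) (Fin d) ℝ) (w : Euc d) :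
    quadForm (invEntries A) w = w.ofLp ⬝ᵥ A⁻¹.mulVec w.ofLp := by
  rw [quadForm_eq_sum_linForm]; rfl

lemma norm_sq_eq_dotProduct (w : Euc d) : ‖w‖ ^ 2 = w.ofLp ⬝ᵥ w.ofLp := by
  rw [EuclideanSpace.real_norm_sq_eq, dotProduct]
  exact Finset.sum_congr rfl fun i _ => sq _

lemma norm_sq_le (hA : IsEllipticMatrix lam Lam A) (hlam : 0 < lam) (hLam : 0 < Lam)
    (w : Euc d) : ‖w‖ ^ 2 ≤ Lam * quadForm (invEntries A) w := by
  rw [norm_sq_eq_dotProduct, quadForm_inv_eq]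
  exact (hA.dotProduct_inv_bounds hlam hLam _).1

lemma le_norm_sq (hA : IsEllipticMatrix lam Lam A) (hlam : 0 < lam) (hLam : 0 < Lam)
    (w : Euc d) : lam * quadForm (invEntries A) w ≤ ‖w‖ ^ 2 := by
  rw [norm_sq_eq_dotProduct, quadForm_inv_eq]
  exact (hA.dotProduct_inv_bounds hlam hLam _).2.1

lemma abs_invEntries_le (hA : IsEllipticMatrix lam Lam A) (hlam : 0 < lam) (hLam : 0 < Lam)
    (i j : Fin d) : |invEntries A i j| ≤ lam⁻¹ := by
  change |A⁻¹ i j| ≤ lam⁻¹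
  have h := hA.dotProduct_inv_bounds hlam hLam (Pi.single j 1)
  have hcol : A⁻¹.mulVec (Pi.single j 1) i = A⁻¹ i j := by simp
  set v := A⁻¹.mulVec (Pi.single j 1)
  have h1 : v i * v i ≤ v ⬝ᵥ v :=
    Finset.single_le_sum (f := fun i => v i * v i) (fun k _ => mul_self_nonneg (v k))
      (Finset.mem_univ i)
  have h2 : (Pi.single j 1 : Fin d → ℝ) ⬝ᵥ Pi.single j 1 = 1 := by simp
  rw [hcol] at h1
  rw [h2] at h
  refine abs_le_of_sq_le_sq ?_ (inv_nonneg.2 hlam.le)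
  have h3 : lam * (lam * (v ⬝ᵥ v)) ≤ 1 := by nlinarith [h.2.1, h.2.2]
  have h4 : lam ^ 2 * (A⁻¹ i j) ^ 2 ≤ 1 := by nlinarith [mul_pos hlam hlam]
  rw [inv_pow]
  exact (le_inv_mul_iff₀ (by positivity)).2 h4 |>.trans (by simp)

/-- The resolvent identity `A⁻¹ - A'⁻¹ = A⁻¹ (A' - A) A'⁻¹`, expanded in entries; the `d ^ 2` counts
the terms of the double sum. -/
lemma abs_invEntries_sub_le (hA : IsEllipticMatrix lam Lam A) (hA' : IsEllipticMatrix lam Lam A')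
    (hlam : 0 < lam) (hLam : 0 < Lam) {e : ℝ} (he : ∀ i j, |A i j - A' i j| ≤ e) (i j : Fin d) :
    |invEntries A i j - invEntries A' i j| ≤ d ^ 2 * (lam⁻¹ ^ 2) * e := by
  change |A⁻¹ i j - A'⁻¹ i j| ≤ _
  have h : A⁻¹ - A'⁻¹ = A⁻¹ * (A' - A) * A'⁻¹ := by
    rw [Matrix.mul_sub, Matrix.sub_mul, Matrix.nonsing_inv_mul _ (hA.isUnit_det hlam),
      Matrix.mul_assoc, Matrix.mul_nonsing_inv _ (hA'.isUnit_det hlam), Matrix.one_mul,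
      Matrix.mul_one]
  have h2 : A⁻¹ i j - A'⁻¹ i j = ∑ k, ∑ l, A⁻¹ i l * (A' l k - A l k) * A'⁻¹ k j := by
    rw [← Matrix.sub_apply, h, Matrix.mul_apply]
    exact Finset.sum_congr rfl fun k _ => by
      rw [Matrix.mul_apply, Finset.sum_mul]; simp only [Matrix.sub_apply]
  have h3 : ∀ k l, |A⁻¹ i l * (A' l k - A l k) * A'⁻¹ k j| ≤ lam⁻¹ ^ 2 * e := by
    intro k l
    rw [abs_mul, abs_mul, abs_sub_comm]
    have he0 : 0 ≤ e := (abs_nonneg _).trans (he i j)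
    have := mul_le_mul (mul_le_mul (hA.abs_invEntries_le hlam hLam i l) (he l k) (abs_nonneg _)
      (inv_nonneg.2 hlam.le)) (hA'.abs_invEntries_le hlam hLam k j) (abs_nonneg _)
      (mul_nonneg (inv_nonneg.2 hlam.le) he0)
    refine this.trans (le_of_eq (by ring))
  rw [h2]
  calc _ ≤ ∑ _k : Fin d, ∑ _l : Fin d, lam⁻¹ ^ 2 * e :=
        (Finset.abs_sum_le_sum_abs _ _).trans (Finset.sum_le_sum fun k _ =>
          (Finset.abs_sum_le_sum_abs _ _).trans (Finset.sum_le_sum fun l _ => h3 k l))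
    _ = _ := by simp; ring

end IsEllipticMatrix

/-! ### Kernel bounds uniform over elliptic matrices -/

lemma exists_bound_lipschitz_of_contDiff {E F : Type*} [NormedAddCommGroup E] [NormedSpace ℝ E]
    [NormedAddCommGroup F] [NormedSpace ℝ F] {f : E → F} (hf : ContDiff ℝ (⊤ : ℕ∞) f) {S : Set E}
    (hS : IsCompact S) :
    ∃ K : ℝ, 0 ≤ K ∧ (∀ x ∈ S, ‖f x‖ ≤ K) ∧ ∀ x ∈ S, ∀ y ∈ S, ‖f x - f y‖ ≤ K * ‖x - y‖ := by
  obtain ⟨K₁, hK₁⟩ := hS.exists_bound_of_continuousOn hf.continuous.continuousOn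
  obtain ⟨K₂, hK₂⟩ := LocallyLipschitzOn.exists_lipschitzOnWith_of_compact hS
    ((hf.of_le (by exact_mod_cast le_top)).locallyLipschitz.locallyLipschitzOn (s := S))
  refine ⟨max (max K₁ 0) K₂, le_max_of_le_left (le_max_right _ _),
    fun x hx => (hK₁ x hx).trans (le_max_of_le_left (le_max_left _ _)), fun x hx y hy => ?_⟩
  refine (hK₂.norm_sub_le hx hy).trans ?_
  gcongr
  exact le_max_right _ _

/-- Bounds for the kernels `cutoff (quadForm (invEntries A) ·)` and `hessKernel (invEntries A)`, uniform over all
elliptic matrices `A`. -/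
structure KernelBounds (d : ℕ) (lam Lam K : ℝ) : Prop where
  one_le : 1 ≤ K
  two_le_quadForm : ∀ A : Matrix (Fin d) (Fin d) ℝ, IsEllipticMatrix lam Lam A →
    ∀ w : Euc d, K - 1 ≤ ‖w‖ → 2 ≤ quadForm (invEntries A) w
  abs_hess_le : ∀ A : Matrix (Fin d) (Fin d) ℝ, IsEllipticMatrix lam Lam A →
    ∀ (w : Euc d) (i j : Fin d), |hessKernel (invEntries A) w i j| ≤ K
  abs_hess_sub_le : ∀ A : Matrix (Fin d) (Fin d) ℝ, IsEllipticMatrix lam Lam A →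
    ∀ (w w' : Euc d) (i j : Fin d),
      |hessKernel (invEntries A) w i j - hessKernel (invEntries A) w' i j| ≤ K * ‖w - w'‖
  abs_cutoff_sub_le : ∀ A : Matrix (Fin d) (Fin d) ℝ, IsEllipticMatrix lam Lam A →
    ∀ w w' : Euc d, |cutoff (quadForm (invEntries A) w) - cutoff (quadForm (invEntries A) w')| ≤ K * ‖w - w'‖
  abs_cutoff_matrix_sub_le : ∀ A A' : Matrix (Fin d) (Fin d) ℝ, IsEllipticMatrix lam Lam A →
    IsEllipticMatrix lam Lam A' → ∀ e : ℝ, 0 ≤ e → (∀ i j, |A i j - A' i j| ≤ e) →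
    ∀ w : Euc d, |cutoff (quadForm (invEntries A) w) - cutoff (quadForm (invEntries A') w)| ≤ K * e
  inv_le_mass : ∀ A : Matrix (Fin d) (Fin d) ℝ, IsEllipticMatrix lam Lam A →
    K⁻¹ ≤ ∫ w : Euc d, cutoff (quadForm (invEntries A) w)

lemma integrable_cutoff_of_two_le {f : Euc d → ℝ} (hf : Continuous f) {R : ℝ}
    (hR : ∀ w, R < ‖w‖ → 2 ≤ f w) : Integrable fun w => cutoff (f w) := by
  refine (cutoff_continuous.comp hf).integrable_of_hasCompactSupport
    (HasCompactSupport.intro (isCompact_closedBall (0 : Euc d) R) fun w hw => ?_)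
  exact cutoff_of_ge (hR w (by simpa using hw))

/-- If one point lies beyond radius `R + 1`, then the other is either in the zero region or at
distance at least `1`, and in the latter case the sup bound already gives the Lipschitz bound. -/
lemma abs_sub_le_of_compact_support {f : Euc d → ℝ} {R K : ℝ}
    (h0 : ∀ w, R ≤ ‖w‖ → f w = 0) (hb : ∀ w, |f w| ≤ K)
    (hlip : ∀ w w', ‖w‖ ≤ R + 1 → ‖w'‖ ≤ R + 1 → |f w - f w'| ≤ K * ‖w - w'‖) (w w' : Euc d) :
    |f w - f w'| ≤ K * ‖w - w'‖ := by
  have hK : 0 ≤ K := (abs_nonneg _).trans (hb 0)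
  have key : ∀ w w', R + 1 < ‖w‖ → |f w - f w'| ≤ K * ‖w - w'‖ := by
    intro w w' hw
    rw [h0 w (by linarith), zero_sub, abs_neg]
    by_cases hw' : R ≤ ‖w'‖
    · rw [h0 w' hw', abs_zero]; positivity
    · have h1 : 1 ≤ ‖w - w'‖ := by
        have := norm_sub_norm_le w w'
        push Not at hw'
        linarith
      exact (hb w').trans (le_mul_of_one_le_right hK h1)
  by_cases hw : ‖w‖ ≤ R + 1
  · by_cases hw' : ‖w'‖ ≤ R + 1
    · exact hlip w w' hw hw'
    · rw [abs_sub_comm, norm_sub_rev]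
      exact key w' w (not_le.1 hw')
  · exact key w w' (not_le.1 hw)

/-- Matrix and point vary together in a compact product of balls, so one constant serves all
admissible matrices. This is what makes the final constant depend on ellipticity alone. -/
lemma exists_uniform_bounds {f : (Fin d → Fin d → ℝ) × Euc d → ℝ} (hf : ContDiff ℝ (⊤ : ℕ∞) f)
    {M : ℝ} (hM : 0 ≤ M) (R : ℝ) :
    ∃ K : ℝ, 0 ≤ K ∧
      (∀ B, (∀ i j, |B i j| ≤ M) → ∀ w, ‖w‖ ≤ R → |f (B, w)| ≤ K) ∧
      (∀ B B', (∀ i j, |B i j| ≤ M) → (∀ i j, |B' i j| ≤ M) → ∀ e, 0 ≤ e →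
        (∀ i j, |B i j - B' i j| ≤ e) → ∀ w w', ‖w‖ ≤ R → ‖w'‖ ≤ R → ‖w - w'‖ ≤ e →
        |f (B, w) - f (B', w')| ≤ K * e) := by
  have hpi : ∀ (B : Fin d → Fin d → ℝ) (e : ℝ), 0 ≤ e → (∀ i j, |B i j| ≤ e) → ‖B‖ ≤ e := by
    intro B e he h
    rw [pi_norm_le_iff_of_nonneg he]
    intro i
    rw [pi_norm_le_iff_of_nonneg he]
    exact h i
  obtain ⟨K, hK0, hKb, hKl⟩ := exists_bound_lipschitz_of_contDiff hf
    ((isCompact_closedBall (0 : Fin d → Fin d → ℝ) M).prod (isCompact_closedBall (0 : Euc d) R))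
  have hmem : ∀ (B : Fin d → Fin d → ℝ), (∀ i j, |B i j| ≤ M) → ∀ w : Euc d, ‖w‖ ≤ R →
      (B, w) ∈ closedBall (0 : Fin d → Fin d → ℝ) M ×ˢ closedBall (0 : Euc d) R :=
    fun B hB w hw => ⟨mem_closedBall_zero_iff.2 (hpi B M hM hB), mem_closedBall_zero_iff.2 hw⟩
  refine ⟨K, hK0, fun B hB w hw => hKb _ (hmem B hB w hw),
    fun B B' hB hB' e he hBB w w' hw hw' hww => ?_⟩
  refine (hKl _ (hmem B hB w hw) _ (hmem B' hB' w' hw')).trans ?_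
  refine mul_le_mul_of_nonneg_left ?_ hK0
  rw [Prod.mk_sub_mk, Prod.norm_mk]
  exact max_le (hpi _ e he hBB) hww

lemma exists_hessKernel_bounds (d : ℕ) {M : ℝ} (hM : 0 ≤ M) (R : ℝ) :
    ∃ K : ℝ, 0 ≤ K ∧ ∀ B : Fin d → Fin d → ℝ, (∀ i j, |B i j| ≤ M) → ∀ w : Euc d, ‖w‖ ≤ R →
      ∀ i j, |hessKernel B w i j| ≤ K ∧
        ∀ w', ‖w'‖ ≤ R → |hessKernel B w i j - hessKernel B w' i j| ≤ K * ‖w - w'‖ := by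
  have h := fun i j => exists_uniform_bounds (contDiff_hessKernel_joint (d := d) i j) hM R
  choose K hK0 hKb hKl using h
  have hle : ∀ i j, K i j ≤ ∑ i, ∑ j, K i j := fun i j =>
    (Finset.single_le_sum (fun j _ => hK0 i j) (Finset.mem_univ j)).trans
      (Finset.single_le_sum (f := fun i => ∑ j, K i j)
        (fun i _ => Finset.sum_nonneg fun j _ => hK0 i j) (Finset.mem_univ i))
  refine ⟨∑ i, ∑ j, K i j, Finset.sum_nonneg fun i _ => Finset.sum_nonneg fun j _ => hK0 i j,
    fun B hB w hw i j => ⟨(hKb i j B hB w hw).trans (hle i j), fun w' hw' => ?_⟩⟩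
  refine (hKl i j B B hB hB _ (norm_nonneg (w - w')) (fun i j => ?_) w w' hw hw' le_rfl).trans
    (mul_le_mul_of_nonneg_right (hle i j) (norm_nonneg _))
  rw [sub_self, abs_zero]
  exact norm_nonneg _

/-- On the ball of radius `√lam` the form is at most `1`, hence the cutoff equals `1` there. -/
lemma IsEllipticMatrix.volume_le_integral_cutoff {lam Lam : ℝ} {A : Matrix (Fin d) (Fin d) ℝ}
    (hA : IsEllipticMatrix lam Lam A) (hlam : 0 < lam) (hLam : 0 < Lam)
    (hint : Integrable fun w : Euc d => cutoff (quadForm (invEntries A) w)) :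
    volume.real (closedBall (0 : Euc d) (√lam)) ≤ ∫ w, cutoff (quadForm (invEntries A) w) := by
  calc volume.real (closedBall (0 : Euc d) (√lam))
      = ∫ w in closedBall (0 : Euc d) (√lam), (1 : ℝ) := by simp
    _ = ∫ w in closedBall (0 : Euc d) (√lam), cutoff (quadForm (invEntries A) w) := by
        refine setIntegral_congr_fun measurableSet_closedBall fun w hw => ?_
        refine (cutoff_of_le ?_).symm
        have h2 := hA.le_norm_sq hlam hLam w
        have h3 : ‖w‖ ^ 2 ≤ lam := by
          rw [mem_closedBall_zero_iff] at hw
          calc ‖w‖ ^ 2 ≤ √lam ^ 2 := by gcongr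
            _ = lam := Real.sq_sqrt hlam.le
        have h4 : lam * quadForm (invEntries A) w ≤ lam * 1 := by linarith
        exact le_of_mul_le_mul_left h4 hlam
    _ ≤ _ := setIntegral_le_integral hint (ae_of_all _ fun w => cutoff_nonneg _)

lemma exists_kernelBounds (d : ℕ) {lam Lam : ℝ} (hlam : 0 < lam) (hLam : 0 < Lam) :
    ∃ K, KernelBounds d lam Lam K := by
  have hM : 0 ≤ lam⁻¹ := inv_nonneg.2 hlam.le
  obtain ⟨R, hR⟩ : ∃ R : ℝ, R = 2 * Lam + 1 := ⟨_, rfl⟩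
  have hquad : ∀ A : Matrix (Fin d) (Fin d) ℝ, IsEllipticMatrix lam Lam A →
      ∀ w : Euc d, R ≤ ‖w‖ → 2 ≤ quadForm (invEntries A) w := by
    intro A hA w hw
    have h1 := hA.norm_sq_le hlam hLam w
    have h2 : Lam * 2 ≤ Lam * quadForm (invEntries A) w := by nlinarith
    exact le_of_mul_le_mul_left h2 hLam
  obtain ⟨K₁, hK₁0, hK₁⟩ := exists_hessKernel_bounds d hM (R + 1)
  obtain ⟨K₂, hK₂0, -, hK₂⟩ := exists_uniform_bounds (d := d)
    (f := fun p : (Fin d → Fin d → ℝ) × Euc d => cutoff (quadForm p.1 p.2))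
    (cutoff_contDiff.comp contDiff_quadForm_joint) hM (R + 1)
  have hess0 : ∀ A : Matrix (Fin d) (Fin d) ℝ, IsEllipticMatrix lam Lam A →
      ∀ w : Euc d, R ≤ ‖w‖ → ∀ i j, hessKernel (invEntries A) w i j = 0 := by
    intro A hA w hw i j
    rw [hessKernel, cutoff_of_ge (hquad A hA w hw), deriv_cutoff_of_ge (hquad A hA w hw)]
    ring
  have hessb : ∀ A : Matrix (Fin d) (Fin d) ℝ, IsEllipticMatrix lam Lam A →
      ∀ (w : Euc d) (i j : Fin d), |hessKernel (invEntries A) w i j| ≤ K₁ := by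
    intro A hA w i j
    by_cases hw : ‖w‖ ≤ R + 1
    · exact (hK₁ _ (hA.abs_invEntries_le hlam hLam) w hw i j).1
    · rw [hess0 A hA w (by linarith), abs_zero]; exact hK₁0
  obtain ⟨μ, hμ⟩ : ∃ μ : ℝ, μ = volume.real (closedBall (0 : Euc d) (√lam)) := ⟨_, rfl⟩
  have hμ0 : 0 < μ := hμ ▸ ENNReal.toReal_pos
    (measure_closedBall_pos volume (0 : Euc d) (Real.sqrt_pos.2 hlam)).ne' measure_closedBall_lt_top.ne
  -- `K` collects all the constants: `1 + R` makes `K - 1` at least the vanishing radius, `K₂ + 1`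
  -- also dominates the sup of the cutoff, and `μ⁻¹` gives the lower bound `K⁻¹` for the mass.
  obtain ⟨K, hK⟩ : ∃ K : ℝ,
    K = 1 + R + K₁ + (K₂ + 1) + K₂ * (1 + d ^ 2 * lam⁻¹ ^ 2) + μ⁻¹ := ⟨_, rfl⟩
  have hR0 : 0 < R := by rw [hR]; positivity
  have hd0 : 0 ≤ K₂ * (1 + d ^ 2 * lam⁻¹ ^ 2) := by positivity
  have hμi : 0 < μ⁻¹ := by positivity
  refine ⟨K, ⟨by linarith, fun A hA w hw => hquad A hA w (by linarith),
    fun A hA w i j => (hessb A hA w i j).trans (by linarith), fun A hA w w' i j => ?_,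
    fun A hA w w' => ?_, fun A A' hA hA' e he hAA w => ?_, fun A hA => ?_⟩⟩
  · refine (abs_sub_le_of_compact_support (f := fun w => hessKernel (invEntries A) w i j)
      (fun w hw => hess0 A hA w hw i j) (fun w => hessb A hA w i j)
      (fun w w' hw hw' => (hK₁ _ (hA.abs_invEntries_le hlam hLam) w hw i j).2 w' hw') w w').trans
      (mul_le_mul_of_nonneg_right (by linarith) (norm_nonneg _))
  · refine (abs_sub_le_of_compact_support (f := fun w => cutoff (quadForm (invEntries A) w))
      (K := K₂ + 1) (fun w hw => cutoff_of_ge (hquad A hA w hw))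
      (fun w => (abs_cutoff_le_one _).trans (by linarith))
      (fun w w' hw hw' => ?_) w w').trans
      (mul_le_mul_of_nonneg_right (by linarith) (norm_nonneg _))
    refine (hK₂ _ _ (hA.abs_invEntries_le hlam hLam) (hA.abs_invEntries_le hlam hLam) _
      (norm_nonneg (w - w')) (fun i j => ?_) w w' hw hw' le_rfl).trans
      (mul_le_mul_of_nonneg_right (by linarith) (norm_nonneg _))
    rw [sub_self, abs_zero]
    exact norm_nonneg _
  · by_cases hw : ‖w‖ ≤ R + 1
    · have hc : 0 ≤ (d : ℝ) ^ 2 * lam⁻¹ ^ 2 * e := by positivity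
      refine (hK₂ _ _ (hA.abs_invEntries_le hlam hLam) (hA'.abs_invEntries_le hlam hLam)
        (d ^ 2 * lam⁻¹ ^ 2 * e) hc (hA.abs_invEntries_sub_le hA' hlam hLam hAA) w w hw hw
        (by simpa using hc)).trans ?_
      rw [← mul_assoc]
      refine mul_le_mul_of_nonneg_right ?_ he
      linarith
    · rw [cutoff_of_ge (hquad A hA w (by linarith)), cutoff_of_ge (hquad A' hA' w (by linarith)),
        sub_self, abs_zero]
      exact mul_nonneg (by linarith) he
  · have hint : Integrable fun w : Euc d => cutoff (quadForm (invEntries A) w) :=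
      integrable_cutoff_of_two_le (contDiff_quadForm _).continuous
        fun w hw => hquad A hA w (le_of_lt hw)
    refine le_trans ?_ (hA.volume_le_integral_cutoff hlam hLam hint)
    rw [← hμ, inv_le_comm₀ (by linarith) hμ0]
    linarith

/-! ### Local means and their dependence on the scale -/

/-- The average of `m` at scale `t` around `x`, weighted by the (unnormalised) kernel
`cutoff (quadForm B ·)`. -/
noncomputable def localMean (m : Euc d → ℝ) (B : Fin d → Fin d → ℝ) (x : Euc d) (t : ℝ) : ℝ :=
  t⁻¹ ^ d * ∫ y, m y * cutoff (quadForm B (t⁻¹ • (y - x)))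

/-- `m` is an integrable function, vanishing outside `U` and solving the adjoint equation in `U`,
for coefficients `A` that are uniformly elliptic in `U`. -/
structure AdjointSolution (lam Lam : ℝ) (U : Set (Euc d)) (A : Euc d → Matrix (Fin d) (Fin d) ℝ)
    (m : Euc d → ℝ) : Prop where
  elliptic : ∀ x ∈ U, IsEllipticMatrix lam Lam (A x)
  measurable_coeff : ∀ i j, Measurable fun x => A x i j
  measurable : Measurable m
  integrable : Integrable m
  eq_zero : ∀ x, x ∉ U → m x = 0
  weak : ∀ φ : Euc d → ℝ, ContDiff ℝ (⊤ : ℕ∞) φ → HasCompactSupport φ → tsupport φ ⊆ U →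
    ∫ x, m x * ∑ i, ∑ j, A x i j * partialTwo φ i j x = 0

lemma abs_integral_mul_le {m F : Euc d → ℝ} {S : Set (Euc d)} (hS : MeasurableSet S) {c : ℝ}
    (hm : IntegrableOn m S) (hF : ∀ y ∈ S, |F y| ≤ c) (hF0 : ∀ y, y ∉ S → F y = 0) :
    |∫ y, m y * F y| ≤ c * ∫ y in S, |m y| := by
  have h : c * ∫ y in S, |m y| = ∫ y, S.indicator (fun y => c * |m y|) y := by
    rw [integral_indicator hS, integral_const_mul]
  rw [h, ← Real.norm_eq_abs]
  have hint : IntegrableOn (fun y => c * |m y|) S := Integrable.const_mul (Integrable.abs hm) c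
  refine norm_integral_le_of_norm_le (hint.integrable_indicator hS) (ae_of_all _ fun y => ?_)
  by_cases hy : y ∈ S
  · rw [indicator_of_mem hy, Real.norm_eq_abs, abs_mul, mul_comm]
    exact mul_le_mul_of_nonneg_right (hF y hy) (abs_nonneg _)
  · simp [indicator_of_notMem hy, hF0 y hy]

lemma abs_sum_mul_le {a b : Fin d → Fin d → ℝ} {e c : ℝ} (ha : ∀ i j, |a i j| ≤ e)
    (hb : ∀ i j, |b i j| ≤ c) : |∑ i, ∑ j, a i j * b i j| ≤ d ^ 2 * c * e := by
  calc _ ≤ ∑ _i : Fin d, ∑ _j : Fin d, e * c :=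
        (Finset.abs_sum_le_sum_abs _ _).trans (Finset.sum_le_sum fun i _ =>
          (Finset.abs_sum_le_sum_abs _ _).trans (Finset.sum_le_sum fun j _ => by
            rw [abs_mul]
            exact mul_le_mul (ha i j) (hb i j) (abs_nonneg _) ((abs_nonneg _).trans (ha i j))))
    _ = _ := by simp; ring

lemma deriv_cutoff_of_le {s : ℝ} (h : s ≤ 1) : deriv cutoff s = 0 := by
  have h1 : HasDerivWithinAt cutoff (deriv cutoff s) (Iic s) s :=
    (hasDerivAt_cutoff s).hasDerivWithinAt
  have h2 : HasDerivWithinAt cutoff 0 (Iic s) s :=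
    (hasDerivWithinAt_const s (Iic s) (1 : ℝ)).congr (fun y hy => cutoff_of_le (le_trans hy h))
      (cutoff_of_le h)
  exact (uniqueDiffWithinAt_Iic s).eq_deriv _ h1 h2

/-- The derivative of the cutoff lives on `[1, 2]`. The bound supplies the dominating function for
differentiating the local means under the integral. -/
lemma exists_abs_mul_deriv_cutoff_le : ∃ C, ∀ s : ℝ, |2 * s * deriv cutoff s| ≤ C := by
  obtain ⟨C, hC⟩ := (isCompact_Icc (a := (1 : ℝ)) (b := 2)).exists_bound_of_continuousOn
    (f := fun s : ℝ => 2 * s * deriv cutoff s)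
    ((continuous_const.mul continuous_id).mul deriv_cutoff_continuous).continuousOn
  have hC0 : 0 ≤ C := (norm_nonneg _).trans (hC 1 (by simp))
  refine ⟨C, fun s => ?_⟩
  rcases le_total s 1 with h | h
  · simpa [deriv_cutoff_of_le h] using hC0
  rcases le_total 2 s with h' | h'
  · simpa [deriv_cutoff_of_ge h'] using hC0
  · exact hC s ⟨h, h'⟩

lemma continuous_quadForm_rescale (B : Fin d → Fin d → ℝ) (x : Euc d) (t : ℝ) :
    Continuous fun y : Euc d => quadForm B (t⁻¹ • (y - x)) :=
  (contDiff_quadForm B).continuous.comp (contDiff_rescale x t).continuous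

lemma integrable_mul_cutoff {m : Euc d → ℝ} (hm : Integrable m) (B : Fin d → Fin d → ℝ)
    (x : Euc d) (t : ℝ) : Integrable fun y => m y * cutoff (quadForm B (t⁻¹ • (y - x))) :=
  hm.mul_bdd (c := 1)
    (cutoff_continuous.comp (continuous_quadForm_rescale B x t)).aestronglyMeasurable
    (ae_of_all _ fun _ => abs_cutoff_le_one _)

/-- Pure calculus, valid for any integrable `m`. The bracket `d h + 2 q h'` is the one computed in
`sum_mul_hessKernel`, and this is where the equation will enter. -/
lemma hasDerivAt_localMean {m : Euc d → ℝ} (hm : Integrable m) (B : Fin d → Fin d → ℝ) (x : Euc d)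
    {t : ℝ} (ht : 0 < t) :
    HasDerivAt (localMean m B x)
      (-t⁻¹ ^ (d + 1) * ∫ y, m y * (d * cutoff (quadForm B (t⁻¹ • (y - x)))
        + 2 * quadForm B (t⁻¹ • (y - x)) * deriv cutoff (quadForm B (t⁻¹ • (y - x))))) t := by
  obtain ⟨C, hC⟩ := exists_abs_mul_deriv_cutoff_le
  have hg : Continuous fun y : Euc d =>
      2 * quadForm B (t⁻¹ • (y - x)) * deriv cutoff (quadForm B (t⁻¹ • (y - x))) :=
    (continuous_const.mul (continuous_quadForm_rescale B x t)).mul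
      (deriv_cutoff_continuous.comp (continuous_quadForm_rescale B x t))
  have hdiff : ∀ y : Euc d, ∀ s ∈ ball t (t / 2),
      HasDerivAt (fun s : ℝ => m y * cutoff (quadForm B (s⁻¹ • (y - x))))
        (m y * (-s⁻¹ * (2 * quadForm B (s⁻¹ • (y - x))
          * deriv cutoff (quadForm B (s⁻¹ • (y - x)))))) s := by
    intro y s hs
    have hs0 : s ≠ 0 := by
      rintro rfl
      rw [mem_ball, dist_comm, Real.dist_eq, sub_zero, abs_of_pos ht] at hs
      linarith
    simp only [quadForm_smul]
    have h1 := ((hasDerivAt_inv hs0).pow 2).mul_const (quadForm B (y - x))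
    have h2 := (HasDerivAt.comp s (hasDerivAt_cutoff _) h1).const_mul (m y)
    refine h2.congr_deriv ?_
    simp only [Pi.pow_apply, ← inv_pow]
    push_cast
    ring
  have key := hasDerivAt_integral_of_dominated_loc_of_deriv_le (μ := volume)
    (F := fun s y => m y * cutoff (quadForm B (s⁻¹ • (y - x))))
    (F' := fun s y => m y * (-s⁻¹ * (2 * quadForm B (s⁻¹ • (y - x))
          * deriv cutoff (quadForm B (s⁻¹ • (y - x))))))
    (bound := fun y => |m y| * (2 / t * C))
    (ball_mem_nhds t (half_pos ht))
    (Eventually.of_forall fun s => (integrable_mul_cutoff hm B x s).aestronglyMeasurable)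
    (integrable_mul_cutoff hm B x t)
    (hm.aestronglyMeasurable.mul (continuous_const.mul hg).aestronglyMeasurable)
    (ae_of_all _ fun y s hs => ?_) (hm.abs.mul_const _) (ae_of_all _ hdiff)
  · have h2 := ((hasDerivAt_inv ht.ne').pow d).mul key.2
    refine h2.congr_deriv ?_
    have hint1 : Integrable fun y => m y * (2 * quadForm B (t⁻¹ • (y - x))
        * deriv cutoff (quadForm B (t⁻¹ • (y - x)))) :=
      hm.mul_bdd (c := C) hg.aestronglyMeasurable (ae_of_all _ fun _ => hC _)
    simp only [mul_add (m _), mul_left_comm (m _), integral_const_mul]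
    simp only [mul_left_comm (m _)] at hint1
    rw [integral_add ((by
      simpa only [mul_left_comm (m _)] using (integrable_mul_cutoff hm B x t).const_mul (d : ℝ)))
      hint1]
    simp only [integral_const_mul, Pi.pow_apply]
    -- The product rule produces the natural-number exponent `d - 1`, so `d = 0` is treated apart.
    rcases d with _ | d
    · simp
    · simp only [Nat.add_sub_cancel, ← inv_pow]
      ring
  · rw [mem_ball, Real.dist_eq, abs_lt] at hs
    have hs0 : t / 2 < s := by linarith [hs.1]
    have hs1 : s⁻¹ ≤ 2 / t := by
      rw [inv_le_comm₀ (by linarith) (by positivity), inv_div]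
      exact hs0.le
    rw [Real.norm_eq_abs, abs_mul, abs_mul, abs_neg, abs_of_pos (inv_pos.2 (by linarith : 0 < s))]
    gcongr
    exact hC _

namespace KernelBounds

variable {lam Lam K : ℝ} {A : Matrix (Fin d) (Fin d) ℝ}

lemma two_le_quadForm_rescale (hK : KernelBounds d lam Lam K) (hA : IsEllipticMatrix lam Lam A)
    {x y : Euc d} {t : ℝ} (ht : 0 < t) (hy : (K - 1) * t ≤ dist y x) :
    2 ≤ quadForm (invEntries A) (t⁻¹ • (y - x)) := by
  refine hK.two_le_quadForm A hA _ ?_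
  rw [norm_smul, norm_inv, Real.norm_of_nonneg ht.le, ← dist_eq_norm, inv_mul_eq_div,
    le_div_iff₀ ht]
  exact hy

lemma hessKernel_rescale_eq_zero (hK : KernelBounds d lam Lam K) (hA : IsEllipticMatrix lam Lam A)
    {x y : Euc d} {t : ℝ} (ht : 0 < t) (hy : (K - 1) * t ≤ dist y x) (i j : Fin d) :
    hessKernel (invEntries A) (t⁻¹ • (y - x)) i j = 0 := by
  have h := hK.two_le_quadForm_rescale hA ht hy
  rw [hessKernel, cutoff_of_ge h, deriv_cutoff_of_ge h]
  ring

lemma cutoff_rescale_eq_zero (hK : KernelBounds d lam Lam K) (hA : IsEllipticMatrix lam Lam A)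
    {x y : Euc d} {t : ℝ} (ht : 0 < t) (hy : (K - 1) * t ≤ dist y x) :
    cutoff (quadForm (invEntries A) (t⁻¹ • (y - x))) = 0 :=
  cutoff_of_ge (hK.two_le_quadForm_rescale hA ht hy)

/-- The kernels vanish already from radius `(K - 1) t` on. The spare `t` between this and `K t`
later absorbs a shift of the centre. -/
lemma sub_one_mul_le_of_notMem (_ : KernelBounds d lam Lam K) {x y : Euc d} {t : ℝ} (ht : 0 < t)
    (hy : y ∉ closedBall x (K * t)) : (K - 1) * t ≤ dist y x := by
  rw [mem_closedBall, not_le] at hy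
  nlinarith

end KernelBounds

namespace AdjointSolution

variable {lam Lam K : ℝ} {U : Set (Euc d)} {A : Euc d → Matrix (Fin d) (Fin d) ℝ} {m : Euc d → ℝ}

/-- The equation tested with `bump`: the kernel is frozen at `p`, while the coefficients contracted
with it are the true `A y`. -/
lemma integral_hessKernel_eq_zero (hS : AdjointSolution lam Lam U A m)
    (hK : KernelBounds d lam Lam K) {p x : Euc d} (hp : p ∈ U) {t : ℝ} (ht : 0 < t)
    (hU : closedBall x (K * t) ⊆ U) :
    ∫ y, m y * ∑ i, ∑ j, A y i j * hessKernel (invEntries (A p)) (t⁻¹ • (y - x)) i j = 0 := by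
  have hsub : tsupport (bump (invEntries (A p)) x t) ⊆ closedBall x (K * t) := by
    refine closure_minimal (fun y hy => ?_) isClosed_closedBall
    by_contra hy'
    exact hy (cutoffPrim_of_ge (hK.two_le_quadForm_rescale (hS.elliptic p hp) ht
      (hK.sub_one_mul_le_of_notMem ht hy')))
  have h := hS.weak _ (contDiff_bump (invEntries (A p)) x t)
    ((isCompact_closedBall x (K * t)).of_isClosed_subset (isClosed_tsupport _) hsub)
    (hsub.trans hU)
  simp only [partialTwo_bump (hS.elliptic p hp).invEntries_comm, mul_left_comm _ (t⁻¹ ^ 2),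
    ← Finset.mul_sum, integral_const_mul] at h
  exact (mul_eq_zero.1 h).resolve_left (by positivity)

/-- The derivative of the local means in the scale. -/
lemma hasDerivAt_localMean (hS : AdjointSolution lam Lam U A m)
    (hK : KernelBounds d lam Lam K) (hlam : 0 < lam) {p x : Euc d} (hp : p ∈ U) {t : ℝ} (ht : 0 < t)
    (hU : closedBall x (K * t) ⊆ U) {e : ℝ}
    (he : ∀ y ∈ closedBall x (K * t), ∀ i j, |A p i j - A y i j| ≤ e) :
    Integrable (fun y => m y * ∑ i, ∑ j, (A p i j - A y i j)
        * hessKernel (invEntries (A p)) (t⁻¹ • (y - x)) i j) ∧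
    HasDerivAt (localMean m (invEntries (A p)) x)
      (-t⁻¹ ^ (d + 1) * ∫ y, m y * ∑ i, ∑ j, (A p i j - A y i j)
        * hessKernel (invEntries (A p)) (t⁻¹ • (y - x)) i j) t := by
  have hA := hS.elliptic p hp
  have hcont : ∀ i j, Continuous fun y : Euc d =>
      hessKernel (invEntries (A p)) (t⁻¹ • (y - x)) i j := fun i j =>
    (contDiff_hessKernel _ i j).continuous.comp (contDiff_rescale x t).continuous
  have h1 : Integrable (fun y => m y * ∑ i, ∑ j, (A p i j - A y i j)
        * hessKernel (invEntries (A p)) (t⁻¹ • (y - x)) i j) := by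
    refine hS.integrable.mul_bdd (c := |(d : ℝ) ^ 2 * K * e|) ?_ (ae_of_all _ fun y => ?_)
    · refine Measurable.aestronglyMeasurable ?_
      exact Finset.measurable_sum _ fun i _ => Finset.measurable_sum _ fun j _ =>
        (measurable_const.sub (hS.measurable_coeff i j)).mul (hcont i j).measurable
    · by_cases hy : y ∈ closedBall x (K * t)
      · exact (abs_sum_mul_le (he y hy) fun i j => hK.abs_hess_le _ hA _ i j).trans (le_abs_self _)
      · simp only [hK.hessKernel_rescale_eq_zero hA ht (hK.sub_one_mul_le_of_notMem ht hy),
          mul_zero, Finset.sum_const_zero, norm_zero]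
        exact abs_nonneg _
  have h2 : Integrable (fun y => m y * ∑ i, ∑ j, A p i j
        * hessKernel (invEntries (A p)) (t⁻¹ • (y - x)) i j) := by
    refine hS.integrable.mul_bdd (c := (d : ℝ) ^ 2 * K * ∑ i, ∑ j, |A p i j|) ?_
      (ae_of_all _ fun y => ?_)
    · exact (continuous_finsetSum _ fun i _ => continuous_finsetSum _ fun j _ =>
        continuous_const.mul (hcont i j)).aestronglyMeasurable
    · refine abs_sum_mul_le (fun i j => ?_) fun i j => hK.abs_hess_le _ hA _ i j
      exact (Finset.single_le_sum (f := fun j => |A p i j|) (fun j _ => abs_nonneg _)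
        (Finset.mem_univ j)).trans (Finset.single_le_sum (f := fun i => ∑ j, |A p i j|)
        (fun i _ => Finset.sum_nonneg fun j _ => abs_nonneg _) (Finset.mem_univ i))
  refine ⟨h1, (_root_.hasDerivAt_localMean hS.integrable _ x ht).congr_deriv ?_⟩
  congr 1
  -- The bracket becomes `A p` contracted with the Hessian kernel. Subtracting the tested equation,
  -- which is zero, turns `A p` into `A p - A y`.
  simp only [← sum_mul_hessKernel hA.invEntries_comm (hA.sum_mul_invEntries hlam)]
  have h3 := integral_sub h2 h1
  rw [← sub_eq_zero, ← h3, ← hS.integral_hessKernel_eq_zero hK hp ht hU]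
  congr 1
  ext y
  rw [← mul_sub, ← Finset.sum_sub_distrib]
  congr 1
  refine Finset.sum_congr rfl fun i _ => ?_
  rw [← Finset.sum_sub_distrib]
  exact Finset.sum_congr rfl fun j _ => by ring

/-- Comparison of the local means at the scales `t` and `t / 2`. -/
lemma abs_localMean_sub_le (hS : AdjointSolution lam Lam U A m)
    (hK : KernelBounds d lam Lam K) (hlam : 0 < lam) {p x : Euc d} (hp : p ∈ U) {t : ℝ} (ht : 0 < t)
    (hU : closedBall x (K * t) ⊆ U) {e : ℝ}
    (he : ∀ y ∈ closedBall x (K * t), ∀ i j, |A p i j - A y i j| ≤ e) :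
    |localMean m (invEntries (A p)) x t - localMean m (invEntries (A p)) x (t / 2)|
      ≤ 2 ^ d * d ^ 2 * K * e * (t⁻¹ ^ d * ∫ y in closedBall x (K * t), |m y|) := by
  have hA := hS.elliptic p hp
  have hK0 : 0 < K := one_pos.trans_le hK.one_le
  have hsub : ∀ s ∈ Icc (t / 2) t, closedBall x (K * s) ⊆ closedBall x (K * t) := fun s hs =>
    closedBall_subset_closedBall (mul_le_mul_of_nonneg_left hs.2 hK0.le)
  have hb := Convex.norm_image_sub_le_of_norm_hasDerivWithin_le
    (f := localMean m (invEntries (A p)) x) (s := Icc (t / 2) t) (x := t / 2) (y := t)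
    -- On `[t / 2, t]` one has `s⁻¹ ≤ 2 / t`. Multiplied by the length `t / 2` of the interval, `(2
    -- / t) ^ (d + 1)` becomes `2 ^ d * t⁻¹ ^ d`.
    (C := (2 / t) ^ (d + 1) * (d ^ 2 * K * e * ∫ y in closedBall x (K * t), |m y|))
    (fun s hs => (hS.hasDerivAt_localMean hK hlam hp (by linarith [hs.1]) ((hsub s hs).trans hU)
      fun y hy => he y (hsub s hs hy)).2.hasDerivWithinAt)
    (fun s hs => ?_) (convex_Icc _ _) (by constructor <;> linarith) (by constructor <;> linarith)
  · refine hb.trans (le_of_eq ?_)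
    rw [Real.norm_of_nonneg (by linarith), div_pow, inv_pow, pow_succ, pow_succ]
    field_simp
    ring
  · have hs0 : 0 < s := by linarith [hs.1]
    rw [norm_mul, norm_neg, norm_pow, norm_inv, Real.norm_of_nonneg hs0.le]
    refine mul_le_mul ?_ ?_ (norm_nonneg _) (by positivity)
    · refine pow_le_pow_left₀ (by positivity) ?_ _
      rw [inv_le_comm₀ hs0 (by positivity), inv_div]
      exact hs.1
    · refine abs_integral_mul_le measurableSet_closedBall hS.integrable.integrableOn
        (fun y hy => abs_sum_mul_le (he y hy) fun i j => hK.abs_hess_le _ hA _ i j) fun y hy => ?_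
      have hy' : y ∉ closedBall x (K * s) := fun h => hy (hsub s hs h)
      simp [hK.hessKernel_rescale_eq_zero hA hs0 (hK.sub_one_mul_le_of_notMem hs0 hy')]

/-- Comparison of the differences of local means at the scales `t` and `t / 2`. -/
lemma abs_localMean_sub_sub_le (hS : AdjointSolution lam Lam U A m)
    (hK : KernelBounds d lam Lam K) (hlam : 0 < lam) {p x x' : Euc d} (hp : p ∈ U) {t : ℝ}
    (ht : 0 < t) (hxx : dist x x' ≤ t / 2)
    (hU : closedBall x (2 * (K * t)) ⊆ U) {e : ℝ}
    (he : ∀ y ∈ closedBall x (2 * (K * t)), ∀ i j, |A p i j - A y i j| ≤ e) :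
    |(localMean m (invEntries (A p)) x t - localMean m (invEntries (A p)) x' t)
        - (localMean m (invEntries (A p)) x (t / 2) - localMean m (invEntries (A p)) x' (t / 2))|
      ≤ 2 ^ (d + 1) * d ^ 2 * K * e * (dist x x' / t)
        * (t⁻¹ ^ d * ∫ y in closedBall x (K * t), |m y|) := by
  have hA := hS.elliptic p hp
  have hK1 := hK.one_le
  have hK0 : 0 < K := one_pos.trans_le hK.one_le
  have hsub : ∀ s ∈ Icc (t / 2) t, closedBall x (K * s) ⊆ closedBall x (K * t) := fun s hs =>
    closedBall_subset_closedBall (mul_le_mul_of_nonneg_left hs.2 hK0.le)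
  have htK : t ≤ K * t := le_mul_of_one_le_left ht.le hK1
  have hsub1 : closedBall x (K * t) ⊆ closedBall x (2 * (K * t)) :=
    closedBall_subset_closedBall (by linarith)
  have hsub2 : ∀ s ∈ Icc (t / 2) t, closedBall x' (K * s) ⊆ closedBall x (2 * (K * t)) := by
    refine fun s hs => closedBall_subset_closedBall' ?_
    have := mul_le_mul_of_nonneg_left hs.2 hK0.le
    rw [dist_comm]
    linarith
  have hd : ∀ s ∈ Icc (t / 2) t, 0 < s := fun s hs => by linarith [hs.1]
  have hder := fun s hs => hS.hasDerivAt_localMean hK hlam hp (hd s hs)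
    (((hsub s hs).trans hsub1).trans hU) fun y hy => he y (hsub1 (hsub s hs hy))
  have hder' := fun s hs => hS.hasDerivAt_localMean hK hlam hp (hd s hs)
    ((hsub2 s hs).trans hU) fun y hy => he y (hsub2 s hs hy)
  have hb := Convex.norm_image_sub_le_of_norm_hasDerivWithin_le
    (f := fun s => localMean m (invEntries (A p)) x s - localMean m (invEntries (A p)) x' s)
    (s := Icc (t / 2) t) (x := t / 2) (y := t)
    -- The sup bound of the Hessian kernel is replaced by its Lipschitz bound: at scale `s ≥ t / 2`
    -- the two rescaled arguments differ by at most `2 / t * dist x x'`.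
    (C := (2 / t) ^ (d + 1) * (d ^ 2 * (K * (2 / t * dist x x')) * e
      * ∫ y in closedBall x (K * t), |m y|))
    (fun s hs => ((hder s hs).2.sub (hder' s hs).2).hasDerivWithinAt)
    (fun s hs => ?_) (convex_Icc _ _) (by constructor <;> linarith) (by constructor <;> linarith)
  · refine hb.trans (le_of_eq ?_)
    rw [Real.norm_of_nonneg (by linarith), div_pow, inv_pow, pow_succ, pow_succ]
    field_simp
    ring
  · have hs0 : 0 < s := hd s hs
    have hsi : s⁻¹ ≤ 2 / t := by
      rw [inv_le_comm₀ hs0 (by positivity), inv_div]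
      exact hs.1
    rw [← mul_sub, ← integral_sub (hder s hs).1 (hder' s hs).1, norm_mul, norm_neg, norm_pow,
      norm_inv, Real.norm_of_nonneg hs0.le]
    refine mul_le_mul (pow_le_pow_left₀ (by positivity) hsi _) ?_ (norm_nonneg _) (by positivity)
    simp only [← mul_sub, ← Finset.sum_sub_distrib]
    refine abs_integral_mul_le measurableSet_closedBall hS.integrable.integrableOn
      (fun y hy => abs_sum_mul_le (he y (hsub1 hy)) fun i j => ?_) fun y hy => ?_
    · refine (hK.abs_hess_sub_le _ hA _ _ i j).trans (mul_le_mul_of_nonneg_left ?_ hK0.le)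
      rw [← smul_sub, sub_sub_sub_cancel_left, norm_smul, norm_inv, Real.norm_of_nonneg hs0.le,
        ← dist_eq_norm, dist_comm]
      exact mul_le_mul_of_nonneg_right hsi dist_nonneg
    · rw [mem_closedBall, not_le] at hy
      have h1 : (K - 1) * s ≤ dist y x := by nlinarith [hs.2]
      -- The shift `dist x x' ≤ t / 2 ≤ s` fits in the gap between `K t` and `(K - 1) s`, so one
      -- ball around `x` contains both supports.
      have h2 : (K - 1) * s ≤ dist y x' := by
        have := dist_triangle y x' x
        rw [dist_comm x' x] at this
        nlinarith [hs.2, hs.1]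
      simp [hK.hessKernel_rescale_eq_zero hA hs0 h1, hK.hessKernel_rescale_eq_zero hA hs0 h2]

end AdjointSolution

/-! ### Dyadic potentials and absorption in `L¹` -/

/-- The integral of `g` over the ball of radius `s` around `x`, divided by `s ^ d`. -/
noncomputable def ballMean (g : Euc d → ℝ≥0∞) (s : ℝ) (x : Euc d) : ℝ≥0∞ :=
  ENNReal.ofReal (s⁻¹ ^ d) * ∫⁻ y in closedBall x s, g y

/-- A dyadic fractional integral of `g`, localised at the scale `D x`. -/
noncomputable def dyadicPotential (κ : ℝ) (D : Euc d → ℝ) (g : Euc d → ℝ≥0∞) (x : Euc d) : ℝ≥0∞ :=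
  ∑' k : ℕ, ENNReal.ofReal κ ^ k * ballMean g (D x / 8 / 2 ^ k) x

lemma volume_closedBall_euc (x : Euc d) {s : ℝ} (hs : 0 ≤ s) :
    volume (closedBall x s) = ENNReal.ofReal (s ^ d) * volume (ball (0 : Euc d) 1) := by
  rw [Measure.addHaar_closedBall volume x hs, finrank_euclideanSpace_fin]

lemma ofReal_inv_pow_mul_ofReal_pow {s : ℝ} (hs : 0 < s) :
    ENNReal.ofReal (s⁻¹ ^ d) * ENNReal.ofReal (s ^ d) = 1 := by
  rw [← ENNReal.ofReal_mul (by positivity), ← mul_pow, inv_mul_cancel₀ hs.ne', one_pow,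
    ENNReal.ofReal_one]

lemma ballMean_le_add {g G : Euc d → ℝ≥0∞} {s : ℝ} (hs : 0 < s) {x : Euc d} {c : ℝ≥0∞}
    (hG : Measurable G) (h : ∀ y ∈ closedBall x s, g y ≤ G y + c) :
    ballMean g s x ≤ ballMean G s x + volume (ball (0 : Euc d) 1) * c := by
  rw [ballMean, ballMean]
  calc _ ≤ ENNReal.ofReal (s⁻¹ ^ d) * ∫⁻ y in closedBall x s, (G y + c) :=
        mul_le_mul_right (setLIntegral_mono' measurableSet_closedBall h) _
    _ = ENNReal.ofReal (s⁻¹ ^ d) * (∫⁻ y in closedBall x s, G y)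
          + (ENNReal.ofReal (s⁻¹ ^ d) * ENNReal.ofReal (s ^ d))
            * volume (ball (0 : Euc d) 1) * c := by
        rw [lintegral_add_left hG, setLIntegral_const, volume_closedBall_euc x hs.le]
        ring
    _ = _ := by rw [ofReal_inv_pow_mul_ofReal_pow hs, one_mul]

/-- By Tonelli. Radii are at most `D / 8` and `D` is 1-Lipschitz, so `D x` and `D y` agree up to a
factor `2` whenever `y` is in the ball around `x`. The points `x` that see `y` then lie in a ball of
radius `2 s(y)` and carry weight at most `2 ^ d s(y)^(-d)`, for a total of `4 ^ d |B₁|`, independent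
of `k`. -/
lemma lintegral_ballMean_le {D : Euc d → ℝ} (hD : LipschitzWith 1 D) {G : Euc d → ℝ≥0∞}
    (hG : Measurable G) (k : ℕ) :
    Measurable (fun x => ballMean G (D x / 8 / 2 ^ k) x) ∧
    ∫⁻ x in {x | 0 < D x}, ballMean G (D x / 8 / 2 ^ k) x
      ≤ 4 ^ d * volume (ball (0 : Euc d) 1) * ∫⁻ y, G y := by
  have hDc : Continuous D := hD.continuous
  obtain ⟨s, hs⟩ : ∃ s : Euc d → ℝ, s = fun x => D x / 8 / 2 ^ k := ⟨_, rfl⟩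
  have hsc : Continuous s := by rw [hs]; exact (hDc.div_const _).div_const _
  have hsx : ∀ x, D x / 8 / 2 ^ k = s x := fun x => by rw [hs]
  have hsD : ∀ x, s x = (8 * 2 ^ k)⁻¹ * D x := fun x => by
    rw [← hsx, div_div, inv_mul_eq_div]
  have hc : (0 : ℝ) < (8 * 2 ^ k)⁻¹ := by positivity
  have hc1 : ((8 : ℝ) * 2 ^ k)⁻¹ ≤ 8⁻¹ := by
    have : (1 : ℝ) ≤ 2 ^ k := one_le_pow₀ (by norm_num)
    gcongr
    linarith
  have hU : MeasurableSet {x | 0 < D x} := measurableSet_lt measurable_const hDc.measurable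
  set S : Set (Euc d × Euc d) := {p | dist p.2 p.1 ≤ s p.1} with hS
  have hSm : MeasurableSet S := measurableSet_le
    (continuous_snd.dist continuous_fst).measurable (hsc.comp continuous_fst).measurable
  have hF : Measurable fun p : Euc d × Euc d =>
      S.indicator (fun p => ENNReal.ofReal ((s p.1)⁻¹ ^ d) * G p.2) p := by
    refine Measurable.indicator (Measurable.mul ?_ (hG.comp measurable_snd)) hSm
    exact (((hsc.measurable.comp measurable_fst).inv).pow_const d).ennreal_ofReal
  have heq : ∀ x, ballMean G (D x / 8 / 2 ^ k) x
      = ∫⁻ y, S.indicator (fun p => ENNReal.ofReal ((s p.1)⁻¹ ^ d) * G p.2) (x, y) := by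
    intro x
    rw [hsx, ballMean, ← lintegral_const_mul _ hG, ← lintegral_indicator measurableSet_closedBall]
    rfl
  refine ⟨by simp only [heq]; exact hF.lintegral_prod_right', ?_⟩
  simp only [heq]
  rw [lintegral_lintegral_swap hF.aemeasurable, ← lintegral_const_mul _ hG]
  refine lintegral_mono fun y => ?_
  have hDxy : ∀ x, |D y - D x| ≤ dist y x := fun x => by
    simpa [Real.dist_eq] using hD.dist_le_mul y x
  have hpt : ∀ x ∈ {x | 0 < D x}, S.indicator (fun p => ENNReal.ofReal ((s p.1)⁻¹ ^ d) * G p.2) (x, y)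
      ≤ (closedBall y (2 * s y)).indicator
        (fun _ => ENNReal.ofReal (2 ^ d * (s y)⁻¹ ^ d) * G y) x ∧
        (S.indicator (fun p => ENNReal.ofReal ((s p.1)⁻¹ ^ d) * G p.2) (x, y) ≠ 0 → 0 < D y) := by
    intro x hx
    by_cases hxy : (x, y) ∈ S
    · have hx : 0 < D x := hx
      have h1 : dist y x ≤ s x := hxy
      have h2 : s x ≤ 8⁻¹ * D x := by rw [hsD]; exact mul_le_mul_of_nonneg_right hc1 hx.le
      have h3 := abs_le.1 (hDxy x)
      have hy0 : 0 < D y := by linarith [h3.1]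
      have h4 : s x ≤ 2 * s y := by
        rw [hsD, hsD, mul_left_comm]
        exact mul_le_mul_of_nonneg_left (by linarith [h3.1]) hc.le
      have h5 : s y ≤ 2 * s x := by
        rw [hsD, hsD, mul_left_comm]
        exact mul_le_mul_of_nonneg_left (by linarith [h3.2]) hc.le
      have hsy : 0 < s y := by rw [hsD]; positivity
      have hsx : 0 < s x := by rw [hsD]; positivity
      have hmem : x ∈ closedBall y (2 * s y) := by
        rw [mem_closedBall, dist_comm]; exact h1.trans h4
      refine ⟨?_, fun _ => hy0⟩
      rw [indicator_of_mem hxy, indicator_of_mem hmem]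
      refine mul_le_mul_left (ENNReal.ofReal_le_ofReal ?_) _
      rw [← mul_pow]
      refine pow_le_pow_left₀ (by positivity) ?_ _
      rw [← div_eq_mul_inv, le_div_iff₀ hsy, inv_mul_le_iff₀ hsx, mul_comm]
      exact h5
    · rw [indicator_of_notMem hxy]
      exact ⟨zero_le, fun h => absurd rfl h⟩
  by_cases hy : 0 < D y
  · have hsy : 0 < s y := by rw [hsD]; positivity
    calc _ ≤ ∫⁻ x in {x | 0 < D x}, (closedBall y (2 * s y)).indicator
          (fun _ => ENNReal.ofReal (2 ^ d * (s y)⁻¹ ^ d) * G y) x :=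
          setLIntegral_mono' hU fun x hx => (hpt x hx).1
      _ ≤ ∫⁻ x, (closedBall y (2 * s y)).indicator
          (fun _ => ENNReal.ofReal (2 ^ d * (s y)⁻¹ ^ d) * G y) x := setLIntegral_le_lintegral _ _
      _ = ENNReal.ofReal (2 ^ d * (s y)⁻¹ ^ d) * ENNReal.ofReal ((2 * s y) ^ d)
          * (volume (ball (0 : Euc d) 1) * G y) := by
          rw [lintegral_indicator measurableSet_closedBall, setLIntegral_const,
            volume_closedBall_euc y (by positivity)]
          ring
      _ = _ := by
          rw [← ENNReal.ofReal_mul (by positivity), show (2 : ℝ) ^ d * (s y)⁻¹ ^ d * (2 * s y) ^ d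
            = 4 ^ d by
              rw [← mul_pow, ← mul_pow]; congr 1; field_simp; norm_num]
          rw [ENNReal.ofReal_pow (by norm_num), ENNReal.ofReal_ofNat]
          ring
  · refine le_trans (le_of_eq ?_) zero_le
    refine (setLIntegral_congr_fun hU fun x hx => ?_).trans lintegral_zero
    by_contra h
    exact hy ((hpt x hx).2 h)

/-- A function that is bounded by `a D ^ (-d)` plus a small multiple of its dyadic potential is
bounded by `2 a D ^ (-d)`. -/
lemma ae_le_of_le_dyadicPotential {κ : ℝ} {D : Euc d → ℝ} (hD : LipschitzWith 1 D)
    {g : Euc d → ℝ≥0∞} (hg : Measurable g) (hgi : ∫⁻ x, g x ≠ ⊤) {a θ : ℝ≥0∞}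
    (hθ : θ * ((∑' k : ℕ, ENNReal.ofReal κ ^ k) * (4 ^ d * volume (ball (0 : Euc d) 1))) ≤ 2⁻¹)
    (h : ∀ᵐ x, 0 < D x →
      g x ≤ a * ENNReal.ofReal ((D x)⁻¹ ^ d) + θ * dyadicPotential κ D g x) :
    ∀ᵐ x, 0 < D x → g x ≤ 2 * a * ENNReal.ofReal ((D x)⁻¹ ^ d) := by
  have hDc : Continuous D := hD.continuous
  set W : ℝ≥0∞ := ∑' k : ℕ, ENNReal.ofReal κ ^ k with hW
  set ω : ℝ≥0∞ := volume (ball (0 : Euc d) 1) with hω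
  have hU : MeasurableSet {x | 0 < D x} := measurableSet_lt measurable_const hDc.measurable
  set P : Euc d → ℝ≥0∞ := fun x => ENNReal.ofReal ((D x)⁻¹ ^ d) with hP
  have hPm : Measurable P := ((hDc.measurable.inv).pow_const d).ennreal_ofReal
  -- The excess of `g` over the claimed bound, by truncated subtraction. The goal is `G = 0` almost
  -- everywhere.
  set G : Euc d → ℝ≥0∞ := {x | 0 < D x}.indicator fun x => g x - 2 * a * P x with hG
  have hGm : Measurable G := (hg.sub (measurable_const.mul hPm)).indicator hU
  have hstep : ∀ x, 0 < D x → dyadicPotential κ D g x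
      ≤ dyadicPotential κ D G x + W * (ω * (2 * a * (2 ^ d * P x))) := by
    intro x hx
    rw [dyadicPotential, dyadicPotential, hW, ← ENNReal.tsum_mul_right, ← ENNReal.tsum_add]
    refine ENNReal.tsum_le_tsum fun k => ?_
    rw [← mul_add]
    refine mul_le_mul_right (ballMean_le_add (by positivity) hGm fun y hy => ?_) _
    have h1 : D x / 8 / 2 ^ k ≤ D x / 8 :=
      div_le_self (by positivity) (one_le_pow₀ (by norm_num))
    have h2 : |D y - D x| ≤ dist y x := by simpa [Real.dist_eq] using hD.dist_le_mul y x
    have h3 := abs_le.1 (h2.trans ((mem_closedBall.1 hy).trans h1))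
    have hy0 : 0 < D y := by linarith [h3.1]
    have h4 : P y ≤ 2 ^ d * P x := by
      rw [hP]
      dsimp only
      rw [← ENNReal.ofReal_ofNat 2, ← ENNReal.ofReal_pow (by norm_num),
        ← ENNReal.ofReal_mul (by positivity), ← mul_pow]
      refine ENNReal.ofReal_le_ofReal (pow_le_pow_left₀ (by positivity) ?_ _)
      rw [← div_eq_mul_inv, le_div_iff₀ hx, inv_mul_le_iff₀ hy0]
      linarith [h3.1]
    rw [hG, indicator_of_mem (show y ∈ {x | 0 < D x} from hy0)]
    exact le_tsub_add.trans (add_le_add_right (mul_le_mul_right h4 _) _)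
  have hGle : ∀ᵐ x, 0 < D x → G x ≤ θ * dyadicPotential κ D G x := by
    filter_upwards [h] with x hx hx0
    rw [hG, indicator_of_mem (show x ∈ {x | 0 < D x} from hx0), tsub_le_iff_right]
    -- The potential of the barrier `2 a P` costs `2 ^ d`, from the comparability of `D`. Enlarging
    -- it to `4 ^ d` lets the hypothesis on `θ` be used a first time, to bound that contribution by
    -- `a P`; its second use is the `L¹` contraction below.
    have h24 : (2 : ℝ≥0∞) ^ d ≤ 4 ^ d := pow_le_pow_left₀ zero_le (by norm_num) _
    calc g x ≤ a * P x + θ * dyadicPotential κ D g x := hx hx0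
      _ ≤ a * P x + θ * (dyadicPotential κ D G x + W * (ω * (2 * a * (4 ^ d * P x)))) := by
          refine add_le_add_right (mul_le_mul_right ((hstep x hx0).trans ?_) _) _
          gcongr
      _ = θ * dyadicPotential κ D G x + (a * P x + (θ * (W * (4 ^ d * ω))) * (2 * a * P x)) := by
          ring
      _ ≤ θ * dyadicPotential κ D G x + (a * P x + 2⁻¹ * (2 * a * P x)) := by gcongr
      _ = _ := by
          congr 1
          rw [mul_assoc 2 a, ← mul_assoc 2⁻¹, ENNReal.inv_mul_cancel (by norm_num) (by norm_num),
            one_mul, two_mul]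
  have hGi : ∫⁻ x, G x ≠ ⊤ := by
    refine ne_top_of_le_ne_top hgi (lintegral_mono fun x => ?_)
    by_cases hx : 0 < D x <;> simp [hG, hx]
  have hGG : ∫⁻ x, G x ≤ 2⁻¹ * ∫⁻ x, G x := by
    calc ∫⁻ x, G x = ∫⁻ x in {x | 0 < D x}, G x := by
          rw [← lintegral_indicator hU, hG, indicator_indicator, inter_self]
      _ ≤ ∫⁻ x in {x | 0 < D x}, θ * dyadicPotential κ D G x :=
          lintegral_mono_ae ((ae_restrict_iff' hU).2 hGle)
      _ = θ * ∑' k : ℕ, ENNReal.ofReal κ ^ k *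
            ∫⁻ x in {x | 0 < D x}, ballMean G (D x / 8 / 2 ^ k) x := by
          simp only [dyadicPotential]
          rw [lintegral_const_mul, lintegral_tsum]
          · congr 2
            ext k
            rw [lintegral_const_mul _ (lintegral_ballMean_le hD hGm k).1]
          · exact fun k => ((lintegral_ballMean_le hD hGm k).1.const_mul _).aemeasurable
          · exact Measurable.tsum fun k => (lintegral_ballMean_le hD hGm k).1.const_mul _
      _ ≤ θ * ∑' k : ℕ, ENNReal.ofReal κ ^ k * (4 ^ d * ω * ∫⁻ y, G y) := by
          gcongr with k
          exact (lintegral_ballMean_le hD hGm k).2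
      _ = (θ * (W * (4 ^ d * ω))) * ∫⁻ y, G y := by rw [ENNReal.tsum_mul_right]; ring
      _ ≤ _ := by gcongr
  have hG0 : ∫⁻ x, G x = 0 := by
    by_contra hne
    -- Finiteness of `∫ G`, inherited from `g`, is what allows `∫ G ≤ ∫ G / 2` to be absorbed.
    have := ENNReal.mul_lt_mul_left hne hGi (show (2⁻¹ : ℝ≥0∞) < 1 by simp)
    rw [one_mul] at this
    exact absurd (hGG.trans_lt this) (lt_irrefl _)
  filter_upwards [(lintegral_eq_zero_iff hGm).1 hG0] with x hx hx0
  rw [hG, Pi.zero_apply, indicator_of_mem (show x ∈ {x | 0 < D x} from hx0), tsub_eq_zero_iff_le]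
    at hx
  exact hx

/-! ### Local means at Lebesgue points -/

lemma continuous_cutoff_rescale (B : Fin d → Fin d → ℝ) (x : Euc d) (t : ℝ) :
    Continuous fun y : Euc d => cutoff (quadForm B (t⁻¹ • (y - x))) :=
  cutoff_continuous.comp (continuous_quadForm_rescale B x t)

lemma integral_cutoff_rescale (B : Fin d → Fin d → ℝ) (x : Euc d) {t : ℝ} (ht : 0 < t) :
    ∫ y : Euc d, cutoff (quadForm B (t⁻¹ • (y - x)))
      = t ^ d * ∫ w : Euc d, cutoff (quadForm B w) := by
  rw [integral_sub_right_eq_self (fun y : Euc d => cutoff (quadForm B (t⁻¹ • y))) x,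
    Measure.integral_comp_inv_smul_of_nonneg volume (fun y : Euc d => cutoff (quadForm B y)) ht.le,
    finrank_euclideanSpace_fin, smul_eq_mul]

/-- Local means converge at Lebesgue points. -/
lemma KernelBounds.tendsto_localMean {lam Lam K : ℝ} (hK : KernelBounds d lam Lam K)
    {m : Euc d → ℝ} (hm : Integrable m) :
    ∀ᵐ x, ∀ A : Matrix (Fin d) (Fin d) ℝ, IsEllipticMatrix lam Lam A → ∀ τ : ℝ, 0 < τ →
      Tendsto (fun k : ℕ => localMean m (invEntries A) x (τ / 2 ^ k)) atTop
        (𝓝 ((∫ w, cutoff (quadForm (invEntries A) w)) * m x)) := by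
  have hK0 : 0 < K := one_pos.trans_le hK.one_le
  -- The null set is fixed before the matrix and the initial scale, because later the matrix is `A
  -- x` and the scale depends on `x`.
  filter_upwards [IsUnifLocDoublingMeasure.ae_tendsto_average_norm_sub volume
    hm.locallyIntegrable 1] with x hx A hA τ hτ
  have hδ : Tendsto (fun k : ℕ => K * (τ / 2 ^ k)) atTop (𝓝[>] 0) := by
    refine tendsto_nhdsWithin_iff.2 ⟨?_, Eventually.of_forall fun k => ?_⟩
    · have := (tendsto_pow_atTop_nhds_zero_of_lt_one (r := (1 / 2 : ℝ)) (by norm_num)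
        (by norm_num)).const_mul (K * τ)
      rw [mul_zero] at this
      refine this.congr fun k => ?_
      rw [div_pow, one_pow]; ring
    · exact mem_Ioi.2 (by positivity)
  have h1 := hx (fun _ : ℕ => x) (fun k : ℕ => K * (τ / 2 ^ k)) hδ
    (Eventually.of_forall fun k => mem_closedBall_self (by positivity))
  have h2 := h1.const_mul (K ^ d * volume.real (ball (0 : Euc d) 1))
  rw [mul_zero] at h2
  rw [tendsto_iff_norm_sub_tendsto_zero]
  refine squeeze_zero (fun _ => norm_nonneg _) (fun k => ?_) h2
  obtain ⟨t, ht⟩ : ∃ t, t = τ / 2 ^ k := ⟨_, rfl⟩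
  have ht0 : 0 < t := by rw [ht]; positivity
  rw [← ht]
  have hcut : Integrable fun y => cutoff (quadForm (invEntries A) (t⁻¹ • (y - x))) := by
    refine (continuous_cutoff_rescale _ x t).integrable_of_hasCompactSupport
      (HasCompactSupport.intro (isCompact_closedBall x (K * t)) fun y hy => ?_)
    exact hK.cutoff_rescale_eq_zero hA ht0 (hK.sub_one_mul_le_of_notMem ht0 hy)
  have heq : localMean m (invEntries A) x t - (∫ w, cutoff (quadForm (invEntries A) w)) * m x
      = t⁻¹ ^ d * ∫ y, (m y - m x) * cutoff (quadForm (invEntries A) (t⁻¹ • (y - x))) := by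
    simp only [sub_mul]
    rw [integral_sub (integrable_mul_cutoff hm _ x t) (hcut.const_mul _), integral_const_mul,
      integral_cutoff_rescale _ x ht0, mul_sub, localMean]
    congr 1
    have : t⁻¹ ^ d * t ^ d = 1 := by rw [← mul_pow, inv_mul_cancel₀ ht0.ne', one_pow]
    linear_combination (-(m x) * ∫ w, cutoff (quadForm (invEntries A) w)) * this
  have hb := abs_integral_mul_le (m := fun y => m y - m x)
    (F := fun y => cutoff (quadForm (invEntries A) (t⁻¹ • (y - x))))
    (S := closedBall x (K * t)) (c := 1) measurableSet_closedBall
    (hm.integrableOn.sub (integrableOn_const measure_closedBall_lt_top.ne))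
    (fun y _ => abs_cutoff_le_one _)
    (fun y hy => hK.cutoff_rescale_eq_zero hA ht0 (hK.sub_one_mul_le_of_notMem ht0 hy))
  rw [heq, norm_mul, norm_pow, norm_inv, Real.norm_of_nonneg ht0.le, setAverage_eq,
    Measure.addHaar_real_closedBall volume x (by positivity), finrank_euclideanSpace_fin,
    smul_eq_mul, mul_pow]
  rw [one_mul] at hb
  have hω : 0 < volume.real (ball (0 : Euc d) 1) := ENNReal.toReal_pos
    (measure_ball_pos volume (0 : Euc d) one_pos).ne' measure_ball_lt_top.ne
  refine (mul_le_mul_of_nonneg_left hb (by positivity)).trans (le_of_eq ?_)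
  simp only [Real.norm_eq_abs, inv_pow]
  field_simp

/-! ### Local boundedness under small oscillation -/

/-- The entries of `A` oscillate by at most `ε (dist x y / ρ) ^ β` at distances up to `ρ`. -/
def OscBound (β ρ ε : ℝ) (U : Set (Euc d)) (A : Euc d → Matrix (Fin d) (Fin d) ℝ) : Prop :=
  ∀ x ∈ U, ∀ y ∈ U, dist x y ≤ ρ → ∀ i j, |A x i j - A y i j| ≤ ε * (dist x y / ρ) ^ β

lemma OscBound.abs_sub_le {β ρ ε : ℝ} {U : Set (Euc d)} {A : Euc d → Matrix (Fin d) (Fin d) ℝ}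
    (hA : OscBound β ρ ε U A) (hρ : 0 < ρ) (hε : 0 ≤ ε) (hβ : 0 ≤ β) {x y : Euc d} (hx : x ∈ U)
    (hy : y ∈ U) (k : ℕ) (h : dist x y ≤ ρ / 2 ^ k) (i j : Fin d) :
    |A x i j - A y i j| ≤ ε * ((1 / 2) ^ β) ^ k := by
  refine (hA x hx y hy (h.trans (div_le_self hρ.le (one_le_pow₀ (by norm_num)))) i j).trans ?_
  refine mul_le_mul_of_nonneg_left ?_ hε
  rw [Real.rpow_pow_comm (by norm_num)]
  refine Real.rpow_le_rpow (by positivity) ?_ hβ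
  rw [div_le_iff₀ hρ, div_pow, one_pow, one_div_mul_eq_div]
  exact h

namespace AdjointSolution

variable {lam Lam K : ℝ} {U : Set (Euc d)} {A : Euc d → Matrix (Fin d) (Fin d) ℝ} {m : Euc d → ℝ}

lemma _root_.ofReal_inv_pow_mul_setIntegral_abs (hm : Integrable m) (s : ℝ) (x : Euc d) :
    ENNReal.ofReal (s⁻¹ ^ d * ∫ y in closedBall x s, |m y|) ≤ ballMean (fun y => ‖m y‖ₑ) s x := by
  by_cases hs : 0 ≤ s⁻¹ ^ d
  · rw [ENNReal.ofReal_mul hs, ballMean]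
    simp only [← Real.norm_eq_abs]
    rw [ofReal_integral_norm_eq_lintegral_enorm hm.integrableOn]
  · rw [ENNReal.ofReal_of_nonpos]
    · exact zero_le
    · exact mul_nonpos_of_nonpos_of_nonneg (not_le.1 hs).le (integral_nonneg fun _ => abs_nonneg _)

/-- Almost everywhere bound of a solution by its dyadic potential. -/
lemma ae_enorm_le_dyadicPotential (hS : AdjointSolution lam Lam U A m)
    (hK : KernelBounds d lam Lam K) (hlam : 0 < lam) {β ρ ε : ℝ} (hρ : 0 < ρ) (hε : 0 ≤ ε)
    (hβ : 0 ≤ β) (hosc : OscBound β ρ ε U A) {D : Euc d → ℝ} (hD : LipschitzWith 1 D)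
    (hDρ : ∀ x, D x ≤ ρ) (hDU : U = {x | 0 < D x}) :
    ∀ᵐ x, 0 < D x → ‖m x‖ₑ ≤ ENNReal.ofReal (K * (8 * K) ^ d * ∫ y, |m y|)
        * ENNReal.ofReal ((D x)⁻¹ ^ d)
      + ENNReal.ofReal (K * (2 ^ d * d ^ 2 * K * K ^ d) * ε)
        * dyadicPotential ((1 / 2) ^ β) D (fun y => ‖m y‖ₑ) x := by
  have hK0 : 0 < K := one_pos.trans_le hK.one_le
  filter_upwards [hK.tendsto_localMean hS.integrable] with x hx hDx
  have hxU : x ∈ U := by rw [hDU]; exact hDx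
  have hA := hS.elliptic x hxU
  have hκ : 0 ≤ (1 / 2 : ℝ) ^ β := by positivity
  -- The scales are chosen so that `K * t k` is the radius `D x / 8 / 2 ^ k` of the dyadic
  -- potential; such balls stay inside `U`.
  obtain ⟨t, ht⟩ : ∃ t : ℕ → ℝ, t = fun k => D x / (8 * K) / 2 ^ k := ⟨_, rfl⟩
  have ht0 : ∀ k, 0 < t k := fun k => by rw [ht]; positivity
  have hKt : ∀ k, K * t k = D x / 8 / 2 ^ k := fun k => by rw [ht]; field_simp
  have htK : ∀ k, (t k)⁻¹ = K * (D x / 8 / 2 ^ k)⁻¹ := fun k => by rw [ht]; field_simp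
  have hts : ∀ k, t (k + 1) = t k / 2 := fun k => by rw [ht]; simp only [pow_succ]; field_simp
  have hle1 : ∀ k, D x / 8 / 2 ^ k ≤ D x / 8 := fun k =>
    div_le_self (by positivity) (one_le_pow₀ (by norm_num))
  have hball : ∀ k, closedBall x (K * t k) ⊆ U := by
    intro k y hy
    rw [mem_closedBall, hKt] at hy
    have h1 : |D y - D x| ≤ dist y x := by simpa [Real.dist_eq] using hD.dist_le_mul y x
    have h2 := (abs_le.1 (h1.trans (hy.trans (hle1 k)))).1
    rw [hDU]
    exact show 0 < D y by linarith
  set u : ℕ → ℝ := fun k => localMean m (invEntries (A x)) x (t k) with hu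
  set ν : Euc d → ℝ≥0∞ := fun y => ‖m y‖ₑ with hν
  have hstep : ∀ k, |u (k + 1) - u k| ≤ 2 ^ d * d ^ 2 * K * K ^ d * ε * (((1 / 2) ^ β) ^ k
      * ((D x / 8 / 2 ^ k)⁻¹ ^ d * ∫ y in closedBall x (D x / 8 / 2 ^ k), |m y|)) := by
    intro k
    have h := hS.abs_localMean_sub_le hK hlam hxU (ht0 k) (hball k)
      (e := ε * ((1 / 2) ^ β) ^ k) (fun y hy => ?_)
    · rw [abs_sub_comm]
      simp only [hu, hts]
      refine h.trans (le_of_eq ?_)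
      rw [hKt, htK, mul_pow]
      ring
    · refine hosc.abs_sub_le hρ hε hβ hxU (hball k hy) k ?_
      rw [dist_comm]
      refine (mem_closedBall.1 hy).trans ?_
      rw [hKt]
      gcongr
      linarith [hDρ x]
  have hu0 : |u 0| ≤ (8 * K) ^ d * (∫ y, |m y|) * (D x)⁻¹ ^ d := by
    have h := abs_integral_mul_le (m := m)
      (F := fun y => cutoff (quadForm (invEntries (A x)) ((t 0)⁻¹ • (y - x)))) (c := 1)
      MeasurableSet.univ hS.integrable.integrableOn (fun y _ => abs_cutoff_le_one _)
      (fun y hy => absurd (mem_univ y) hy)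
    rw [one_mul, setIntegral_univ] at h
    simp only [hu, localMean]
    rw [abs_mul, abs_of_nonneg (pow_nonneg (inv_nonneg.2 (ht0 0).le) d)]
    refine (mul_le_mul_of_nonneg_left h (pow_nonneg (inv_nonneg.2 (ht0 0).le) d)).trans
      (le_of_eq ?_)
    rw [htK, pow_zero, div_one, inv_div, mul_div_assoc', div_eq_mul_inv, mul_pow, mul_comm K 8]
    ring
  have hN : ∀ N, ENNReal.ofReal |u N| ≤ ENNReal.ofReal ((8 * K) ^ d * (∫ y, |m y|) * (D x)⁻¹ ^ d)
      + ENNReal.ofReal (2 ^ d * d ^ 2 * K * K ^ d * ε) * dyadicPotential ((1 / 2) ^ β) D ν x := by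
    intro N
    have h1 : |u N| ≤ |u 0| + ∑ k ∈ Finset.range N, |u (k + 1) - u k| := by
      have h2 := dist_le_range_sum_dist u N
      simp only [Real.dist_eq] at h2
      have h3 : |u N| ≤ |u 0| + |u 0 - u N| := by
        rw [abs_sub_comm]
        calc |u N| = |u 0 + (u N - u 0)| := by congr 1; ring
          _ ≤ _ := abs_add_le _ _
      refine h3.trans (add_le_add_right (h2.trans (le_of_eq ?_)) _)
      exact Finset.sum_congr rfl fun k _ => abs_sub_comm _ _
    refine (ENNReal.ofReal_le_ofReal (h1.trans (add_le_add_left hu0 _))).trans ?_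
    refine ENNReal.ofReal_add_le.trans (add_le_add_right ?_ _)
    rw [ENNReal.ofReal_sum_of_nonneg fun _ _ => abs_nonneg _, dyadicPotential,
      ← ENNReal.tsum_mul_left]
    refine (Finset.sum_le_sum fun k _ => ?_).trans (ENNReal.sum_le_tsum (Finset.range N))
    refine (ENNReal.ofReal_le_ofReal (hstep k)).trans ?_
    rw [ENNReal.ofReal_mul (by positivity), ENNReal.ofReal_mul (pow_nonneg hκ k),
      ENNReal.ofReal_pow hκ]
    gcongr
    exact ofReal_inv_pow_mul_setIntegral_abs hS.integrable _ x
  have hlim : Tendsto (fun N => ENNReal.ofReal |u N|) atTop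
      (𝓝 (ENNReal.ofReal |(∫ w, cutoff (quadForm (invEntries (A x)) w)) * m x|)) := by
    refine (ENNReal.continuous_ofReal.tendsto _).comp ((continuous_abs.tendsto _).comp ?_)
    have := hx (A x) hA (D x / (8 * K)) (by positivity)
    simpa only [hu, ht] using this
  have hfin := le_of_tendsto' hlim hN
  have hmass := hK.inv_le_mass _ hA
  -- The limit of the means carries the mass of the kernel, which is at least `K⁻¹`; removing it
  -- costs a factor `K`.
  have hmx : ‖m x‖ₑ
      ≤ ENNReal.ofReal K * ENNReal.ofReal |(∫ w, cutoff (quadForm (invEntries (A x)) w)) * m x| := by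
    rw [← ENNReal.ofReal_mul hK0.le, ← ofReal_norm, Real.norm_eq_abs]
    refine ENNReal.ofReal_le_ofReal ?_
    rw [abs_mul, ← mul_assoc]
    refine le_mul_of_one_le_left (abs_nonneg _) ?_
    calc (1 : ℝ) = K * K⁻¹ := (mul_inv_cancel₀ hK0.ne').symm
      _ ≤ _ := mul_le_mul_of_nonneg_left (hmass.trans (le_abs_self _)) hK0.le
  refine hmx.trans ((mul_le_mul_right hfin _).trans (le_of_eq ?_))
  have hI : 0 ≤ ∫ y, |m y| := integral_nonneg fun _ => abs_nonneg _
  rw [mul_add, ← mul_assoc, ← ENNReal.ofReal_mul hK0.le, ← ENNReal.ofReal_mul hK0.le,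
    ← ENNReal.ofReal_mul (by positivity)]
  refine congrArg₂ (· + ·) ?_ ?_
  · congr 1; ring
  · congr 2; ring

/-- Local boundedness of solutions, for coefficients of small oscillation. -/
lemma _root_.KernelBounds.exists_ae_abs_le (hK : KernelBounds d lam Lam K) (hlam : 0 < lam) {β : ℝ}
    (hβ : 0 < β) :
    ∃ ε₀ : ℝ, 0 < ε₀ ∧ ∃ C : ℝ, 0 < C ∧ ∀ (U : Set (Euc d))
      (A : Euc d → Matrix (Fin d) (Fin d) ℝ) (m : Euc d → ℝ), AdjointSolution lam Lam U A m →
      ∀ ρ : ℝ, 0 < ρ → OscBound β ρ ε₀ U A → ∀ D : Euc d → ℝ, LipschitzWith 1 D →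
      (∀ x, D x ≤ ρ) → U = {x | 0 < D x} →
      ∀ᵐ x, 0 < D x → |m x| ≤ C * (D x)⁻¹ ^ d * ∫ y, |m y| := by
  have hK0 : 0 < K := one_pos.trans_le hK.one_le
  have hκ0 : (0 : ℝ) < (1 / 2) ^ β := by positivity
  have hκ1 : (1 / 2 : ℝ) ^ β < 1 := Real.rpow_lt_one (by norm_num) (by norm_num) hβ
  set Y : ℝ≥0∞ := (∑' k : ℕ, ENNReal.ofReal ((1 / 2) ^ β) ^ k)
    * (4 ^ d * volume (ball (0 : Euc d) 1)) with hY
  have hYtop : Y ≠ ⊤ := by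
    refine ENNReal.mul_ne_top ?_ (ENNReal.mul_ne_top (by simp) measure_ball_lt_top.ne)
    rw [ENNReal.tsum_geometric, ENNReal.inv_ne_top]
    refine (tsub_pos_of_lt ?_).ne'
    rw [← ENNReal.ofReal_one]
    exact (ENNReal.ofReal_lt_ofReal_iff one_pos).2 hκ1
  set c : ℝ := K * (2 ^ d * d ^ 2 * K * K ^ d) with hc
  have hc0 : 0 ≤ c := by positivity
  obtain ⟨y, hy0, hYy⟩ : ∃ y : ℝ, 0 ≤ y ∧ Y = ENNReal.ofReal y :=
    ⟨Y.toReal, ENNReal.toReal_nonneg, (ENNReal.ofReal_toReal hYtop).symm⟩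
  -- The smallness required for absorption is `c ε₀ y ≤ 1 / 2`, where `y` is the norm bound of the
  -- dyadic potential on `L¹`, finite because `β > 0`. The `+ 1` avoids division by zero.
  refine ⟨(2 * (c * y + 1))⁻¹, by positivity, 2 * (K * (8 * K) ^ d), by positivity,
    fun U A m hS ρ hρ hosc D hD hDρ hDU => ?_⟩
  have h1 := hS.ae_enorm_le_dyadicPotential hK hlam hρ (by positivity) hβ.le hosc hD hDρ hDU
  have h2 := ae_le_of_le_dyadicPotential hD hS.measurable.enorm hS.integrable.2.ne ?_ h1
  · have hI : 0 ≤ ∫ y, |m y| := integral_nonneg fun _ => abs_nonneg _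
    have h2' : ENNReal.ofReal 2 = 2 := ENNReal.ofReal_ofNat 2
    filter_upwards [h2] with x hx hDx
    have h3 : ENNReal.ofReal |m x| ≤ ENNReal.ofReal
        (2 * (K * (8 * K) ^ d * ∫ y, |m y|) * (D x)⁻¹ ^ d) := by
      rw [ENNReal.ofReal_mul (by positivity), ENNReal.ofReal_mul (by norm_num), h2',
        ← Real.norm_eq_abs, ofReal_norm]
      exact hx hDx
    rw [ENNReal.ofReal_le_ofReal_iff (by positivity)] at h3
    refine h3.trans (le_of_eq ?_)
    ring
  · rw [← hY, hYy, ← ENNReal.ofReal_mul (by positivity), ← ENNReal.ofReal_ofNat 2,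
      ← ENNReal.ofReal_inv_of_pos (by norm_num)]
    refine ENNReal.ofReal_le_ofReal ?_
    rw [← div_eq_mul_inv, div_mul_eq_mul_div, div_le_iff₀ (by positivity)]
    norm_num
    linarith

end AdjointSolution

/-! ### Hölder continuity of bounded solutions -/

/-- The solution `m` is bounded by `S` almost everywhere near the points of `V`, at the scale
`ρ / 2`. -/
structure BoundedNear (m : Euc d → ℝ) (U V : Set (Euc d)) (ρ S : ℝ) : Prop where
  subset : ∀ x ∈ V, closedBall x (ρ / 2) ⊆ U
  ae_le : ∀ x ∈ V, ∀ᵐ y, y ∈ closedBall x (ρ / 2) → |m y| ≤ S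

lemma BoundedNear.mean_abs_le {m : Euc d → ℝ} {U V : Set (Euc d)} {ρ S K t : ℝ}
    (hb : BoundedNear m U V ρ S) (hm : Integrable m) (hK : 0 ≤ K) (ht : 0 < t)
    (htρ : K * t ≤ ρ / 2) {x : Euc d} (hx : x ∈ V) :
    t⁻¹ ^ d * ∫ y in closedBall x (K * t), |m y|
      ≤ K ^ d * volume.real (ball (0 : Euc d) 1) * S := by
  have h : ∫ y in closedBall x (K * t), |m y| ≤ ∫ _y in closedBall x (K * t), S := by
    refine setIntegral_mono_on_ae hm.abs.integrableOn
      (integrableOn_const measure_closedBall_lt_top.ne) measurableSet_closedBall ?_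
    filter_upwards [hb.ae_le x hx] with y hy hyx
    exact hy (closedBall_subset_closedBall htρ hyx)
  rw [setIntegral_const, Measure.addHaar_real_closedBall volume x (mul_nonneg hK ht.le),
    finrank_euclideanSpace_fin, smul_eq_mul, mul_pow] at h
  refine (mul_le_mul_of_nonneg_left h (by positivity)).trans (le_of_eq ?_)
  have : t⁻¹ ^ d * t ^ d = 1 := by rw [← mul_pow, inv_mul_cancel₀ ht.ne', one_pow]
  linear_combination (K ^ d * volume.real (ball (0 : Euc d) 1) * S) * this

lemma abs_localMean_sub_localMean_le {m : Euc d → ℝ} (hm : Integrable m)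
    {B B' : Fin d → Fin d → ℝ} {x x' z : Euc d} {t c R : ℝ} (ht : 0 < t)
    (hc : ∀ y, |cutoff (quadForm B (t⁻¹ • (y - x))) - cutoff (quadForm B' (t⁻¹ • (y - x')))| ≤ c)
    (h0 : ∀ y, y ∉ closedBall z R → cutoff (quadForm B (t⁻¹ • (y - x))) = 0
      ∧ cutoff (quadForm B' (t⁻¹ • (y - x'))) = 0) :
    |localMean m B x t - localMean m B' x' t| ≤ c * (t⁻¹ ^ d * ∫ y in closedBall z R, |m y|) := by
  rw [localMean, localMean, ← mul_sub, ← integral_sub (integrable_mul_cutoff hm _ _ _)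
    (integrable_mul_cutoff hm _ _ _), abs_mul, abs_of_nonneg (by positivity), mul_left_comm]
  refine mul_le_mul_of_nonneg_left ?_ (by positivity)
  simp only [← mul_sub]
  exact abs_integral_mul_le measurableSet_closedBall hm.integrableOn (fun y _ => hc y)
    fun y hy => by rw [(h0 y hy).1, (h0 y hy).2, sub_zero]

lemma abs_localMean_le {m : Euc d → ℝ} (hm : Integrable m) {B : Fin d → Fin d → ℝ} {x z : Euc d}
    {t R : ℝ} (ht : 0 < t)
    (h0 : ∀ y, y ∉ closedBall z R → cutoff (quadForm B (t⁻¹ • (y - x))) = 0) :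
    |localMean m B x t| ≤ t⁻¹ ^ d * ∫ y in closedBall z R, |m y| := by
  rw [localMean, abs_mul, abs_of_nonneg (by positivity)]
  refine mul_le_mul_of_nonneg_left ?_ (by positivity)
  rw [← one_mul (∫ y in closedBall z R, |m y|)]
  exact abs_integral_mul_le measurableSet_closedBall hm.integrableOn
    (fun y _ => abs_cutoff_le_one _) h0

lemma KernelBounds.abs_mass_sub_le {lam Lam K : ℝ} (hK : KernelBounds d lam Lam K)
    {A A' : Matrix (Fin d) (Fin d) ℝ} (hA : IsEllipticMatrix lam Lam A)
    (hA' : IsEllipticMatrix lam Lam A') {e : ℝ} (he0 : 0 ≤ e) (he : ∀ i j, |A i j - A' i j| ≤ e) :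
    |(∫ w, cutoff (quadForm (invEntries A) w)) - ∫ w, cutoff (quadForm (invEntries A') w)|
      ≤ K * e * (K ^ d * volume.real (ball (0 : Euc d) 1)) := by
  have hK0 : 0 < K := one_pos.trans_le hK.one_le
  have hint : ∀ A : Matrix (Fin d) (Fin d) ℝ, IsEllipticMatrix lam Lam A →
      Integrable fun w : Euc d => cutoff (quadForm (invEntries A) w) := fun A hA =>
    integrable_cutoff_of_two_le (contDiff_quadForm _).continuous
      fun w hw => hK.two_le_quadForm A hA w hw.le
  have hz : ∀ A : Matrix (Fin d) (Fin d) ℝ, IsEllipticMatrix lam Lam A →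
      ∀ w : Euc d, w ∉ closedBall (0 : Euc d) K → cutoff (quadForm (invEntries A) w) = 0 := by
    intro A hA w hw
    rw [mem_closedBall_zero_iff, not_le] at hw
    exact cutoff_of_ge (hK.two_le_quadForm A hA w (by linarith))
  rw [← integral_sub (hint A hA) (hint A' hA')]
  have hvol : K * e * (K ^ d * volume.real (ball (0 : Euc d) 1))
      = ∫ w, (closedBall (0 : Euc d) K).indicator (fun _ => K * e) w := by
    rw [integral_indicator measurableSet_closedBall, setIntegral_const,
      Measure.addHaar_real_closedBall volume _ hK0.le, finrank_euclideanSpace_fin, smul_eq_mul]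
    ring
  rw [hvol]
  have hcon : IntegrableOn (fun _ => K * e) (closedBall (0 : Euc d) K) :=
    integrableOn_const measure_closedBall_lt_top.ne
  rw [← Real.norm_eq_abs]
  refine norm_integral_le_of_norm_le (hcon.integrable_indicator measurableSet_closedBall)
    (ae_of_all _ fun w => ?_)
  by_cases hw : w ∈ closedBall (0 : Euc d) K
  · rw [indicator_of_mem hw]
    exact hK.abs_cutoff_matrix_sub_le A A' hA hA' e he0 he w
  · rw [hz A hA w hw, hz A' hA' w hw, sub_zero, norm_zero, indicator_of_notMem hw]

/-- A geometric sum of ratio `2 κ > 1` is dominated by its last term. For `κ = 2^(-β)` the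
hypothesis means `β < 1`; at `β = 1` a factor `k` would appear. -/
lemma sum_range_two_mul_pow_div_le {κ : ℝ} (hκ : 1 < 2 * κ) (k : ℕ) :
    ∑ j ∈ Finset.range k, κ ^ j * (2 ^ j / 2 ^ k) ≤ κ ^ k / (2 * κ - 1) := by
  have h : ∑ j ∈ Finset.range k, κ ^ j * (2 ^ j / 2 ^ k)
      = (∑ j ∈ Finset.range k, (2 * κ) ^ j) / 2 ^ k := by
    rw [Finset.sum_div]
    exact Finset.sum_congr rfl fun j _ => by rw [mul_pow]; ring
  have h1 : 0 < 2 * κ - 1 := by linarith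
  rw [h, geom_sum_eq hκ.ne', div_div, div_le_div_iff₀ (by positivity) h1, mul_pow]
  have : 0 ≤ (2 * κ - 1) := h1.le
  nlinarith

namespace AdjointSolution

variable {lam Lam K : ℝ} {U V : Set (Euc d)} {A : Euc d → Matrix (Fin d) (Fin d) ℝ} {m : Euc d → ℝ}
  {β ρ ε S : ℝ}

/-- Geometric decay of the increments of local means at dyadic scales. -/
lemma abs_localMean_dyadic_sub_le (hS : AdjointSolution lam Lam U A m)
    (hK : KernelBounds d lam Lam K) (hlam : 0 < lam) (hρ : 0 < ρ) (hε : 0 ≤ ε) (hβ : 0 ≤ β)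
    (hosc : OscBound β ρ ε U A) (hb : BoundedNear m U V ρ S) {x : Euc d} (hx : x ∈ V) (k : ℕ) :
    |localMean m (invEntries (A x)) x (ρ / (4 * K) / 2 ^ k)
        - localMean m (invEntries (A x)) x (ρ / (4 * K) / 2 ^ (k + 1))|
      ≤ 2 ^ d * d ^ 2 * K * ε * (K ^ d * volume.real (ball (0 : Euc d) 1)) * S
        * ((1 / 2) ^ β) ^ k := by
  have hK0 : 0 < K := one_pos.trans_le hK.one_le
  have hxU : x ∈ U := hb.subset x hx (mem_closedBall_self (by positivity))
  obtain ⟨t, ht⟩ : ∃ t, t = ρ / (4 * K) / 2 ^ k := ⟨_, rfl⟩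
  have ht0 : 0 < t := by rw [ht]; positivity
  have hKt : K * t = ρ / 4 / 2 ^ k := by rw [ht]; field_simp
  have hKt1 : K * t ≤ ρ / 4 := by
    rw [hKt]; exact div_le_self (by positivity) (one_le_pow₀ (by norm_num))
  have hsub : closedBall x (K * t) ⊆ U :=
    (closedBall_subset_closedBall (by linarith)).trans (hb.subset x hx)
  have h := hS.abs_localMean_sub_le hK hlam hxU ht0 hsub (e := ε * ((1 / 2) ^ β) ^ k)
    (fun y hy => hosc.abs_sub_le hρ hε hβ hxU (hsub hy) k (by
      rw [dist_comm]
      refine (mem_closedBall.1 hy).trans ?_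
      rw [hKt]
      gcongr
      linarith))
  have hm := hb.mean_abs_le hS.integrable hK0.le ht0 (by linarith) hx
  rw [pow_succ, ← div_div (ρ / (4 * K)), ← ht]
  refine h.trans ((mul_le_mul_of_nonneg_left hm (by positivity)).trans (le_of_eq ?_))
  ring

/-- The difference between the two centres is telescoped from scale `0` to scale `k`. The step at
scale `j` carries the oscillation `ε κ^j` and the ratio `dist x x' / t j ≤ 2^(j - k)`. At scale `0`
the Lipschitz bound of the kernel gives `K 2^(-k) ≤ K κ^k`. -/
lemma abs_localMean_centers_sub_le (hS : AdjointSolution lam Lam U A m)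
    (hK : KernelBounds d lam Lam K) (hlam : 0 < lam) (hρ : 0 < ρ) (hε : 0 ≤ ε) (hβ : 0 ≤ β)
    (hβ1 : β < 1) (hosc : OscBound β ρ ε U A) (hS0 : 0 ≤ S) (hb : BoundedNear m U V ρ S)
    {x x' : Euc d} (hx : x ∈ V) (k : ℕ) (hxx : dist x x' ≤ ρ / (4 * K) / 2 ^ k) :
    |localMean m (invEntries (A x)) x (ρ / (4 * K) / 2 ^ k)
        - localMean m (invEntries (A x)) x' (ρ / (4 * K) / 2 ^ k)|
      ≤ (K + 2 ^ (d + 1) * d ^ 2 * K * ε / (2 * (1 / 2) ^ β - 1))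
        * (K ^ d * volume.real (ball (0 : Euc d) 1)) * S * ((1 / 2) ^ β) ^ k := by
  have hK1 := hK.one_le
  have hK0 : 0 < K := one_pos.trans_le hK.one_le
  have hxU : x ∈ U := hb.subset x hx (mem_closedBall_self (by positivity))
  have hA := hS.elliptic x hxU
  set Q : ℝ := K ^ d * volume.real (ball (0 : Euc d) 1) with hQ
  have hQ0 : 0 ≤ Q := by positivity
  obtain ⟨κ, hκ⟩ : ∃ κ : ℝ, κ = (1 / 2) ^ β := ⟨_, rfl⟩
  have hκ0 : 0 < κ := by rw [hκ]; positivity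
  have hκ2 : 1 / 2 < κ := by
    rw [hκ]
    nth_rw 1 [← Real.rpow_one (1 / 2 : ℝ)]
    exact Real.rpow_lt_rpow_of_exponent_gt (by norm_num) (by norm_num) hβ1
  rw [← hκ]
  obtain ⟨t, ht⟩ : ∃ t : ℕ → ℝ, t = fun k => ρ / (4 * K) / 2 ^ k := ⟨_, rfl⟩
  have htk : ∀ k, ρ / (4 * K) / 2 ^ k = t k := fun k => by rw [ht]
  have ht0 : ∀ k, 0 < t k := fun k => by rw [ht]; positivity
  have hKt : ∀ k, K * t k = ρ / 4 / 2 ^ k := fun k => by rw [ht]; field_simp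
  have hts : ∀ k, t (k + 1) = t k / 2 := fun k => by rw [ht]; simp only [pow_succ]; field_simp
  have hKt1 : ∀ k, K * t k ≤ ρ / 4 := fun k => by
    rw [hKt]; exact div_le_self (by positivity) (one_le_pow₀ (by norm_num))
  rw [htk] at hxx ⊢
  have hanti : ∀ j, j < k → t k ≤ t j / 2 := by
    intro j hj
    rw [← hts, ← htk, ← htk]
    exact div_le_div_of_nonneg_left (by positivity) (by positivity)
      (pow_le_pow_right₀ (by norm_num) hj)
  have hratio : ∀ j, dist x x' / t j ≤ 2 ^ j / 2 ^ k := by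
    intro j
    rw [div_le_iff₀ (ht0 j)]
    refine hxx.trans (le_of_eq ?_)
    rw [← htk, ← htk]
    field_simp
  set v : ℕ → ℝ := fun j => localMean m (invEntries (A x)) x (t j)
    - localMean m (invEntries (A x)) x' (t j) with hv
  have hstep : ∀ j ∈ Finset.range k, dist (v j) (v (j + 1))
      ≤ 2 ^ (d + 1) * d ^ 2 * K * ε * Q * S * (κ ^ j * (2 ^ j / 2 ^ k)) := by
    intro j hj
    have hsub : closedBall x (2 * (K * t j)) ⊆ U :=
      (closedBall_subset_closedBall (by linarith [hKt1 j])).trans (hb.subset x hx)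
    have h := hS.abs_localMean_sub_sub_le hK hlam hxU (ht0 j) (x' := x')
      (hxx.trans (hanti j (Finset.mem_range.1 hj))) hsub (e := ε * κ ^ j)
      (fun y hy => by
        rw [hκ]
        refine hosc.abs_sub_le hρ hε hβ hxU (hsub hy) j ?_
        rw [dist_comm]
        refine (mem_closedBall.1 hy).trans ?_
        rw [hKt, ← mul_div_assoc]
        gcongr
        linarith)
    have hm := hb.mean_abs_le hS.integrable hK0.le (ht0 j) (by linarith [hKt1 j]) hx
    rw [Real.dist_eq]
    simp only [hv, hts]
    refine h.trans ((mul_le_mul (mul_le_mul_of_nonneg_left (hratio j) (by positivity)) hm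
      (mul_nonneg (pow_nonneg (inv_nonneg.2 (ht0 j).le) _)
        (integral_nonneg fun _ => abs_nonneg _)) (by positivity)).trans (le_of_eq ?_))
    ring
  have hsum : dist (v 0) (v k) ≤ 2 ^ (d + 1) * d ^ 2 * K * ε * Q * S * (κ ^ k / (2 * κ - 1)) := by
    refine (dist_le_range_sum_dist v k).trans ((Finset.sum_le_sum hstep).trans ?_)
    rw [← Finset.mul_sum]
    exact mul_le_mul_of_nonneg_left (sum_range_two_mul_pow_div_le (by linarith) k) (by positivity)
  have hv0 : |v 0| ≤ K * Q * S * κ ^ k := by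
    have h0t : t k ≤ t 0 := by
      rw [← htk, ← htk, pow_zero, div_one]
      exact div_le_self (by positivity) (one_le_pow₀ (by norm_num))
    have h := abs_localMean_sub_localMean_le hS.integrable (B := invEntries (A x))
      (B' := invEntries (A x)) (x := x) (x' := x') (z := x) (c := K * (1 / 2 ^ k)) (R := K * t 0)
      (ht0 0) (fun y => ?_) (fun y hy => ?_)
    · have hm := hb.mean_abs_le hS.integrable hK0.le (ht0 0) (by linarith [hKt1 0]) hx
      refine h.trans ((mul_le_mul_of_nonneg_left hm (by positivity)).trans ?_)
      have hk : 1 / 2 ^ k ≤ κ ^ k := by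
        rw [← one_div_pow]
        exact pow_le_pow_left₀ (by norm_num) hκ2.le k
      calc K * (1 / 2 ^ k) * (Q * S) = K * Q * S * (1 / 2 ^ k) := by ring
        _ ≤ _ := mul_le_mul_of_nonneg_left hk (by positivity)
    · refine (hK.abs_cutoff_sub_le _ hA _ _).trans (mul_le_mul_of_nonneg_left ?_ hK0.le)
      rw [← smul_sub, sub_sub_sub_cancel_left, norm_smul, norm_inv,
        Real.norm_of_nonneg (ht0 0).le, ← dist_eq_norm, dist_comm, inv_mul_eq_div]
      simpa using hratio 0
    · have h1 := hK.sub_one_mul_le_of_notMem (ht0 0) hy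
      refine ⟨hK.cutoff_rescale_eq_zero hA (ht0 0) h1,
        hK.cutoff_rescale_eq_zero hA (ht0 0) ?_⟩
      rw [mem_closedBall, not_le] at hy
      have := dist_triangle y x' x
      rw [dist_comm x' x] at this
      linarith
  have hfin : |v k| ≤ |v 0| + dist (v 0) (v k) := by
    have h := abs_sub_abs_le_abs_sub (v k) (v 0)
    rw [abs_sub_comm (v k)] at h
    rw [Real.dist_eq]
    linarith
  refine hfin.trans ((add_le_add hv0 hsum).trans (le_of_eq ?_))
  ring

/-- The centre and the scale are unchanged, so only the dependence of the kernel on its matrix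
enters and the equation is not needed beyond ellipticity. -/
lemma abs_localMean_coeff_sub_le (hS : AdjointSolution lam Lam U A m)
    (hK : KernelBounds d lam Lam K) (hρ : 0 < ρ) (hb : BoundedNear m U V ρ S) {x x' : Euc d}
    (hx : x ∈ V) (hx' : x' ∈ V) {e : ℝ} (he0 : 0 ≤ e) (he : ∀ i j, |A x i j - A x' i j| ≤ e)
    (k : ℕ) :
    |localMean m (invEntries (A x)) x' (ρ / (4 * K) / 2 ^ k)
        - localMean m (invEntries (A x')) x' (ρ / (4 * K) / 2 ^ k)|
      ≤ K * e * (K ^ d * volume.real (ball (0 : Euc d) 1) * S) := by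
  have hK0 : 0 < K := one_pos.trans_le hK.one_le
  have hU : ∀ x ∈ V, x ∈ U := fun x hx => hb.subset x hx (mem_closedBall_self (by positivity))
  have hA := hS.elliptic x (hU x hx)
  have hA' := hS.elliptic x' (hU x' hx')
  obtain ⟨t, ht⟩ : ∃ t, t = ρ / (4 * K) / 2 ^ k := ⟨_, rfl⟩
  have ht0 : 0 < t := by rw [ht]; positivity
  have hKt : K * t ≤ ρ / 4 := by
    have : K * t = ρ / 4 / 2 ^ k := by rw [ht]; field_simp
    rw [this]; exact div_le_self (by positivity) (one_le_pow₀ (by norm_num))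
  rw [← ht]
  refine (abs_localMean_sub_localMean_le hS.integrable (z := x') (R := K * t) (c := K * e) ht0
    (fun y => hK.abs_cutoff_matrix_sub_le _ _ hA hA' e he0 he _) (fun y hy => ?_)).trans
    (mul_le_mul_of_nonneg_left (hb.mean_abs_le hS.integrable hK0.le ht0 (by linarith) hx')
      (by positivity))
  have h1 := hK.sub_one_mul_le_of_notMem ht0 hy
  exact ⟨hK.cutoff_rescale_eq_zero hA ht0 h1, hK.cutoff_rescale_eq_zero hA' ht0 h1⟩

/-- Limits of local means along dyadic scales. -/
lemma exists_limit_localMean (hS : AdjointSolution lam Lam U A m)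
    (hK : KernelBounds d lam Lam K) (hlam : 0 < lam) (hρ : 0 < ρ) (hε : 0 ≤ ε) (hβ : 0 < β)
    (hosc : OscBound β ρ ε U A) (hb : BoundedNear m U V ρ S) :
    ∃ ℓ : Euc d → ℝ, ∀ x ∈ V,
      Tendsto (fun k : ℕ => localMean m (invEntries (A x)) x (ρ / (4 * K) / 2 ^ k)) atTop
        (𝓝 (ℓ x)) ∧
      (∀ k : ℕ, |localMean m (invEntries (A x)) x (ρ / (4 * K) / 2 ^ k) - ℓ x|
        ≤ 2 ^ d * d ^ 2 * K * ε * (K ^ d * volume.real (ball (0 : Euc d) 1)) * S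
          * ((1 / 2) ^ β) ^ k / (1 - (1 / 2) ^ β)) ∧
      |ℓ x| ≤ (1 + 2 ^ d * d ^ 2 * K * ε / (1 - (1 / 2) ^ β))
        * (K ^ d * volume.real (ball (0 : Euc d) 1)) * S := by
  have hK0 : 0 < K := one_pos.trans_le hK.one_le
  have hκ1 : (1 / 2 : ℝ) ^ β < 1 := Real.rpow_lt_one (by norm_num) (by norm_num) hβ
  have hex : ∀ x : Euc d, ∃ l : ℝ, x ∈ V →
      Tendsto (fun k : ℕ => localMean m (invEntries (A x)) x (ρ / (4 * K) / 2 ^ k)) atTop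
        (𝓝 l) := by
    intro x
    by_cases hx : x ∈ V
    · obtain ⟨l, hl⟩ := cauchySeq_tendsto_of_complete (cauchySeq_of_le_geometric _ _ hκ1
        (f := fun k : ℕ => localMean m (invEntries (A x)) x (ρ / (4 * K) / 2 ^ k))
        (fun k => by
          rw [Real.dist_eq]
          exact hS.abs_localMean_dyadic_sub_le hK hlam hρ hε hβ.le hosc hb hx k))
      exact ⟨l, fun _ => hl⟩
    · exact ⟨0, fun h => absurd h hx⟩
  choose ℓ hℓ using hex
  refine ⟨ℓ, fun x hx => ?_⟩
  have hxU : x ∈ U := hb.subset x hx (mem_closedBall_self (by positivity))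
  have hA := hS.elliptic x hxU
  have h2 : ∀ k : ℕ, |localMean m (invEntries (A x)) x (ρ / (4 * K) / 2 ^ k) - ℓ x|
        ≤ 2 ^ d * d ^ 2 * K * ε * (K ^ d * volume.real (ball (0 : Euc d) 1)) * S
          * ((1 / 2) ^ β) ^ k / (1 - (1 / 2) ^ β) := fun k => by
    have := dist_le_of_le_geometric_of_tendsto _ _ hκ1
        (f := fun k : ℕ => localMean m (invEntries (A x)) x (ρ / (4 * K) / 2 ^ k))
        (fun k => by
          rw [Real.dist_eq]
          exact hS.abs_localMean_dyadic_sub_le hK hlam hρ hε hβ.le hosc hb hx k) (hℓ x hx) k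
    rwa [Real.dist_eq] at this
  refine ⟨hℓ x hx, h2, ?_⟩
  -- The bound on the limit compares it with the mean at the coarsest scale, which is estimated
  -- directly by the supremum of `|m|`.
  have h3 := h2 0
  rw [pow_zero, pow_zero, div_one, mul_one] at h3
  have ht0 : 0 < ρ / (4 * K) := by positivity
  have hKt : K * (ρ / (4 * K)) ≤ ρ / 2 := by
    have : K * (ρ / (4 * K)) = ρ / 4 := by field_simp
    linarith
  have h4 := (abs_localMean_le hS.integrable (B := invEntries (A x)) (x := x) (z := x)
    (R := K * (ρ / (4 * K))) ht0 fun y hy =>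
    hK.cutoff_rescale_eq_zero hA ht0 (hK.sub_one_mul_le_of_notMem ht0 hy)).trans
    (hb.mean_abs_le hS.integrable hK0.le ht0 hKt hx)
  have h5 := abs_sub_abs_le_abs_sub (ℓ x) (localMean m (invEntries (A x)) x (ρ / (4 * K)))
  rw [abs_sub_comm] at h5
  have h6 : |ℓ x| ≤ K ^ d * volume.real (ball (0 : Euc d) 1) * S
      + 2 ^ d * d ^ 2 * K * ε * (K ^ d * volume.real (ball (0 : Euc d) 1)) * S
        / (1 - (1 / 2) ^ β) := by linarith
  refine h6.trans (le_of_eq ?_)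
  ring

/-- Dyadic Hölder estimate for a continuous version of a bounded solution. -/
lemma _root_.KernelBounds.exists_dyadic_holder (hK : KernelBounds d lam Lam K) (hlam : 0 < lam)
    (hβ : 0 < β) (hβ1 : β < 1) (hε : 0 ≤ ε) :
    ∃ C : ℝ, 0 < C ∧ ∀ (U V : Set (Euc d)) (A : Euc d → Matrix (Fin d) (Fin d) ℝ) (m : Euc d → ℝ),
      AdjointSolution lam Lam U A m → ∀ ρ S : ℝ, 0 < ρ → 0 ≤ S → OscBound β ρ ε U A →
      BoundedNear m U V ρ S →
      ∃ m' : Euc d → ℝ, (∀ᵐ x, x ∈ V → m' x = m x) ∧ (∀ x ∈ V, |m' x| ≤ C * S) ∧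
        ∀ k : ℕ, ∀ x ∈ V, ∀ x' ∈ V, dist x x' ≤ ρ / (4 * K) / 2 ^ k →
          |m' x - m' x'| ≤ C * S * ((1 / 2) ^ β) ^ k := by
  have hK0 : 0 < K := one_pos.trans_le hK.one_le
  obtain ⟨κ, hκ⟩ : ∃ κ : ℝ, κ = (1 / 2) ^ β := ⟨_, rfl⟩
  have hκ0 : 0 < κ := by rw [hκ]; positivity
  have hκ1 : 0 < 1 - κ := by
    rw [hκ]; linarith [Real.rpow_lt_one (x := (1 / 2 : ℝ)) (by norm_num) (by norm_num) hβ]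
  have hκ2 : 0 < 2 * κ - 1 := by
    have : (1 / 2 : ℝ) ^ (1 : ℝ) < (1 / 2) ^ β :=
      Real.rpow_lt_rpow_of_exponent_gt (by norm_num) (by norm_num) hβ1
    rw [Real.rpow_one, ← hκ] at this
    linarith
  set Q : ℝ := K ^ d * volume.real (ball (0 : Euc d) 1) with hQ
  have hQ0 : 0 ≤ Q := by positivity
  set C₁ : ℝ := 2 ^ d * d ^ 2 * K * ε * Q / (1 - κ) with hC₁
  set C₂ : ℝ := (K + 2 ^ (d + 1) * d ^ 2 * K * ε / (2 * κ - 1)) * Q with hC₂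
  set C₃ : ℝ := K * ε * Q with hC₃
  set C₄ : ℝ := (1 + 2 ^ d * d ^ 2 * K * ε / (1 - κ)) * Q with hC₄
  have h1 : 0 ≤ C₁ := by positivity
  have h2 : 0 ≤ C₂ := by positivity
  have h3 : 0 ≤ C₃ := by positivity
  have h4 : 0 ≤ C₄ := by positivity
  refine ⟨1 + K * C₄ + (K * (2 * C₁ + C₂ + C₃) + K ^ 2 * C₄ * C₃), by positivity,
    fun U V A m hS ρ S hρ hS0 hosc hb => ?_⟩
  obtain ⟨ℓ, hℓ⟩ := hS.exists_limit_localMean hK hlam hρ hε hβ hosc hb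
  have hU : ∀ x ∈ V, x ∈ U := fun x hx => hb.subset x hx (mem_closedBall_self (by positivity))
  set c : Euc d → ℝ := fun x => ∫ w, cutoff (quadForm (invEntries (A x)) w) with hc
  have hcK : ∀ x ∈ V, K⁻¹ ≤ c x := fun x hx => hK.inv_le_mass _ (hS.elliptic x (hU x hx))
  have hc0 : ∀ x ∈ V, 0 < c x := fun x hx => (inv_pos.2 hK0).trans_le (hcK x hx)
  have hci : ∀ x ∈ V, (c x)⁻¹ ≤ K := fun x hx => inv_le_of_inv_le₀ hK0 (hcK x hx)
  -- The means converge to mass times value, so the continuous version is the limit divided by the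
  -- mass; it agrees with `m` at the Lebesgue points in `V`.
  refine ⟨fun x => ℓ x / c x, ?_, fun x hx => ?_, fun k x hx x' hx' hxx => ?_⟩
  · filter_upwards [hK.tendsto_localMean hS.integrable] with x hx hxV
    have := tendsto_nhds_unique (hℓ x hxV).1
      (hx (A x) (hS.elliptic x (hU x hxV)) (ρ / (4 * K)) (by positivity))
    rw [this, mul_comm]
    exact mul_div_cancel_right₀ _ (hc0 x hxV).ne'
  · rw [abs_div, abs_of_pos (hc0 x hx), div_eq_mul_inv]
    have h5 := (hℓ x hx).2.2
    rw [← hκ] at h5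
    calc |ℓ x| * (c x)⁻¹ ≤ (C₄ * S) * K :=
          mul_le_mul h5 (hci x hx) (inv_nonneg.2 (hc0 x hx).le) (by positivity)
      _ = (K * C₄) * S := by ring
      _ ≤ _ := by
          refine mul_le_mul_of_nonneg_right ?_ hS0
          have : 0 ≤ K * (2 * C₁ + C₂ + C₃) + K ^ 2 * C₄ * C₃ := by positivity
          linarith
  · have hdist : dist x x' ≤ ρ / 2 ^ k := by
      refine hxx.trans ?_
      gcongr
      refine div_le_self hρ.le ?_
      linarith [hK.one_le]
    have he := hosc.abs_sub_le hρ hε hβ.le (hU x hx) (hU x' hx') k hdist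
    have e1 := (hℓ x hx).2.1 k
    have e1' := (hℓ x' hx').2.1 k
    have e2 := hS.abs_localMean_centers_sub_le hK hlam hρ hε hβ.le hβ1 hosc hS0 hb hx k hxx
    have e3 := hS.abs_localMean_coeff_sub_le hK hρ hb hx hx' (by positivity) he k
    have e4 := hK.abs_mass_sub_le (hS.elliptic x (hU x hx)) (hS.elliptic x' (hU x' hx'))
      (by positivity) he
    have e5 := (hℓ x' hx').2.2
    rw [← hκ] at e1 e1' e2 e3 e4 e5 ⊢
    have hκk : 0 ≤ κ ^ k := by positivity
    -- The path from `ℓ x` to `ℓ x'`: up to scale `k` at `x`, change of centre, change of matrix,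
    -- back down to the limit at `x'`. The two limits account for `2 * C₁`.
    have f1 : |ℓ x - ℓ x'| ≤ (2 * C₁ + C₂ + C₃) * S * κ ^ k := by
      have g1 : 2 ^ d * d ^ 2 * K * ε * Q * S * κ ^ k / (1 - κ) = C₁ * S * κ ^ k := by
        rw [hC₁]; ring
      have g3 : K * (ε * κ ^ k) * (Q * S) = C₃ * S * κ ^ k := by rw [hC₃]; ring
      rw [g1] at e1 e1'
      rw [g3] at e3
      have := abs_le.1 e1
      have := abs_le.1 e1'
      have := abs_le.1 e2
      have := abs_le.1 e3
      have expand : (2 * C₁ + C₂ + C₃) * S * κ ^ k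
        = C₁ * S * κ ^ k + C₁ * S * κ ^ k + C₂ * S * κ ^ k + C₃ * S * κ ^ k := by ring
      rw [expand]
      exact abs_le.2 ⟨by linarith, by linarith⟩
    have f2 : |c x' - c x| ≤ C₃ * κ ^ k := by
      rw [abs_sub_comm]
      refine e4.trans (le_of_eq ?_)
      rw [hC₃]; ring
    have hsplit : ℓ x / c x - ℓ x' / c x'
        = (ℓ x - ℓ x') * (c x)⁻¹ + ℓ x' * (c x' - c x) * ((c x)⁻¹ * (c x')⁻¹) := by
      have := (hc0 x hx).ne'
      have := (hc0 x' hx').ne'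
      field_simp
      ring
    rw [hsplit]
    refine (abs_add_le _ _).trans ?_
    have g1 : |(ℓ x - ℓ x') * (c x)⁻¹| ≤ (2 * C₁ + C₂ + C₃) * S * κ ^ k * K := by
      rw [abs_mul, abs_of_pos (inv_pos.2 (hc0 x hx))]
      exact mul_le_mul f1 (hci x hx) (inv_nonneg.2 (hc0 x hx).le) (by positivity)
    have g2 : |ℓ x' * (c x' - c x) * ((c x)⁻¹ * (c x')⁻¹)| ≤ (C₄ * S) * (C₃ * κ ^ k) * (K * K) := by
      rw [abs_mul, abs_mul, abs_mul, abs_of_pos (inv_pos.2 (hc0 x hx)),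
        abs_of_pos (inv_pos.2 (hc0 x' hx'))]
      exact mul_le_mul (mul_le_mul e5 f2 (abs_nonneg _) (by positivity))
        (mul_le_mul (hci x hx) (hci x' hx') (inv_nonneg.2 (hc0 x' hx').le) hK0.le)
        (mul_nonneg (inv_nonneg.2 (hc0 x hx).le) (inv_nonneg.2 (hc0 x' hx').le)) (by positivity)
    refine (add_le_add g1 g2).trans ?_
    have : 0 ≤ (1 + K * C₄) * S * κ ^ k := by positivity
    linarith

end AdjointSolution

/-- Hölder estimate for a continuous version of a bounded solution. -/
lemma KernelBounds.exists_holder {lam Lam K β ε : ℝ} (hK : KernelBounds d lam Lam K)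
    (hlam : 0 < lam) (hβ : 0 < β) (hβ1 : β < 1) (hε : 0 ≤ ε) :
    ∃ C : ℝ, 0 < C ∧ ∀ (U V : Set (Euc d)) (A : Euc d → Matrix (Fin d) (Fin d) ℝ) (m : Euc d → ℝ),
      AdjointSolution lam Lam U A m → ∀ ρ S : ℝ, 0 < ρ → 0 ≤ S → OscBound β ρ ε U A →
      BoundedNear m U V ρ S →
      ∃ m' : Euc d → ℝ, (∀ᵐ x, x ∈ V → m' x = m x) ∧ (∀ x ∈ V, |m' x| ≤ C * S) ∧
        ∀ x ∈ V, ∀ x' ∈ V, |m' x - m' x'| ≤ C * S * (dist x x' / ρ) ^ β := by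
  have hK0 : 0 < K := one_pos.trans_le hK.one_le
  obtain ⟨C, hC, h⟩ := hK.exists_dyadic_holder hlam hβ hβ1 hε
  have hle : ∀ s : ℝ, 1 ≤ s → s ^ β ≤ s := fun s hs => by
    simpa using Real.rpow_le_rpow_of_exponent_le hs hβ1.le
  refine ⟨8 * K * C, by positivity, fun U V A m hS ρ S hρ hS0 hosc hb => ?_⟩
  obtain ⟨m', h1, h2, h3⟩ := h U V A m hS ρ S hρ hS0 hosc hb
  have hCS : 0 ≤ C * S := by positivity
  refine ⟨m', h1, fun x hx => (h2 x hx).trans ?_, fun x hx x' hx' => ?_⟩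
  · nlinarith [hK.one_le]
  rcases eq_or_ne x x' with rfl | hne
  · rw [sub_self, abs_zero]; positivity
  have hd0 : 0 < dist x x' := dist_pos.2 hne
  obtain ⟨τ, hτ⟩ : ∃ τ, τ = ρ / (4 * K) := ⟨_, rfl⟩
  have hτ0 : 0 < τ := by rw [hτ]; positivity
  have hρτ : ρ = 4 * K * τ := by rw [hτ]; field_simp
  have key : ∀ c : ℝ, 1 ≤ c → (c * (dist x x' / ρ)) ^ β ≤ c * (dist x x' / ρ) ^ β := by
    intro c hc
    rw [Real.mul_rpow (by linarith) (by positivity)]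
    exact mul_le_mul_of_nonneg_right (hle c hc) (by positivity)
  have hdr : 0 ≤ (dist x x' / ρ) ^ β := by positivity
  -- For close points, `k` is chosen with `dist x x' / τ` between `2^(-k-1)` and `2^(-k)`; the lost
  -- factor `2` and `τ = ρ / (4 K)` give `8 K`. For distant points the sup bound suffices.
  rcases le_total (dist x x') τ with hd | hd
  · obtain ⟨k, hk1, hk2⟩ := exists_nat_pow_near_of_lt_one (x := dist x x' / τ) (y := (1 / 2 : ℝ))
      (by positivity) ((div_le_one hτ0).2 hd) (by norm_num) (by norm_num)
    have h4 := h3 k x hx x' hx' (by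
      rw [← hτ]
      rw [div_le_iff₀ hτ0, one_div_pow, one_div_mul_eq_div] at hk2
      exact hk2)
    refine h4.trans ?_
    have h5 : ((1 / 2 : ℝ) ^ β) ^ k ≤ 8 * K * (dist x x' / ρ) ^ β := by
      rw [Real.rpow_pow_comm (by norm_num)]
      refine le_trans (Real.rpow_le_rpow (by positivity) ?_ hβ.le) (key _ (by linarith [hK.one_le]))
      rw [pow_succ] at hk1
      have : dist x x' / τ = 4 * K * (dist x x' / ρ) := by rw [hρτ]; field_simp
      rw [this] at hk1
      linarith
    refine (mul_le_mul_of_nonneg_left h5 hCS).trans (le_of_eq ?_)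
    ring
  · have h5 : 1 ≤ 4 * K * (dist x x' / ρ) ^ β := by
      refine le_trans ?_ (key (4 * K) (by linarith [hK.one_le]))
      refine Real.one_le_rpow ?_ hβ.le
      rw [hρτ, mul_div_mul_left _ _ (by positivity : 4 * K ≠ 0) |> fun h => (by
        rw [← mul_div_assoc, h] : 4 * K * (dist x x' / (4 * K * τ)) = dist x x' / τ)]
      exact (one_le_div hτ0).2 hd
    have h6 : |m' x - m' x'| ≤ 2 * (C * S) := by
      have a1 := abs_le.1 (h2 x hx)
      have a2 := abs_le.1 (h2 x' hx')
      exact abs_le.2 ⟨by linarith, by linarith⟩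
    calc _ ≤ 2 * (C * S) * 1 := by rw [mul_one]; exact h6
      _ ≤ 2 * (C * S) * (4 * K * (dist x x' / ρ) ^ β) :=
          mul_le_mul_of_nonneg_left h5 (by positivity)
      _ = _ := by ring

/-! ### The interior estimate at a scale of small oscillation -/

/-- This is the weight `D` for the local boundedness: the distance to the sphere, truncated at `ρ`
because the oscillation is controlled only up to that distance. -/
lemma lipschitzWith_min_sub_norm (ρ R : ℝ) : LipschitzWith 1 fun x : Euc d => min ρ (R - ‖x‖) := by
  refine LipschitzWith.of_dist_le_mul fun x y => ?_
  rw [NNReal.coe_one, one_mul, Real.dist_eq]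
  refine (abs_min_sub_min_le_max _ _ _ _).trans ?_
  rw [sub_self, abs_zero, sub_sub_sub_cancel_left]
  refine max_le dist_nonneg ?_
  rw [dist_comm, dist_eq_norm]
  exact abs_norm_sub_norm_le _ _

/-- The interior Hölder estimate at a scale `ρ` at which the oscillation of the coefficients is
small. -/
lemma exists_interior_estimate (d : ℕ) {lam Lam β : ℝ} (hlam : 0 < lam) (hLam : 0 < Lam)
    (hβ : 0 < β) (hβ1 : β < 1) :
    ∃ ε : ℝ, 0 < ε ∧ ∃ C : ℝ, 0 < C ∧ ∀ r ρ : ℝ, 0 < ρ → ρ ≤ r →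
      ∀ (A : Euc d → Matrix (Fin d) (Fin d) ℝ) (m : Euc d → ℝ),
      AdjointSolution lam Lam (ball 0 (2 * r)) A m → OscBound β ρ ε (ball 0 (2 * r)) A →
      ∃ m' : Euc d → ℝ, (∀ᵐ x, x ∈ ball (0 : Euc d) r → m' x = m x) ∧
        (∀ x ∈ ball (0 : Euc d) r, |m' x| ≤ C * (ρ⁻¹ ^ d * ∫ y, |m y|)) ∧
        ∀ x ∈ ball (0 : Euc d) r, ∀ x' ∈ ball (0 : Euc d) r,
          |m' x - m' x'| ≤ C * (ρ⁻¹ ^ d * ∫ y, |m y|) * (dist x x' / ρ) ^ β := by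
  obtain ⟨K, hK⟩ := exists_kernelBounds d hlam hLam
  obtain ⟨ε, hε, C₁, hC₁, h₁⟩ := hK.exists_ae_abs_le hlam hβ
  obtain ⟨C₂, hC₂, h₂⟩ := hK.exists_holder hlam hβ hβ1 hε.le
  refine ⟨ε, hε, C₂ * (C₁ * 2 ^ d), by positivity, fun r ρ hρ hρr A m hS hosc => ?_⟩
  have hU : ball (0 : Euc d) (2 * r) = {x | 0 < min ρ (2 * r - ‖x‖)} := by
    ext x
    rw [mem_ball_zero_iff]
    change ‖x‖ < 2 * r ↔ 0 < min ρ (2 * r - ‖x‖)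
    rw [lt_min_iff, sub_pos]
    exact ⟨fun h => ⟨hρ, h⟩, fun h => h.2⟩
  have hsup := h₁ _ A m hS ρ hρ hosc _ (lipschitzWith_min_sub_norm ρ (2 * r))
    (fun x => min_le_left _ _) hU
  have hI : 0 ≤ ∫ y, |m y| := integral_nonneg fun _ => abs_nonneg _
  have hnorm : ∀ x ∈ ball (0 : Euc d) r, ∀ y ∈ closedBall x (ρ / 2), ‖y‖ ≤ 2 * r - ρ / 2 := by
    intro x hx y hy
    rw [mem_ball_zero_iff] at hx
    rw [mem_closedBall, dist_eq_norm] at hy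
    have := norm_le_norm_add_norm_sub' y x
    linarith
  -- Points within `ρ / 2` of the ball of radius `r` have weight at least `ρ / 2`, since `ρ ≤ r`;
  -- this costs the factor `2 ^ d`.
  have hb : BoundedNear m (ball 0 (2 * r)) (ball 0 r) ρ (C₁ * 2 ^ d * (ρ⁻¹ ^ d * ∫ y, |m y|)) := by
    refine ⟨fun x hx y hy => ?_, fun x hx => ?_⟩
    · rw [mem_ball_zero_iff]
      linarith [hnorm x hx y hy]
    · filter_upwards [hsup] with y hy hyx
      have hD : ρ / 2 ≤ min ρ (2 * r - ‖y‖) :=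
        le_min (by linarith) (by linarith [hnorm x hx y hyx])
      refine (hy (by linarith)).trans ?_
      have h3 : (min ρ (2 * r - ‖y‖))⁻¹ ^ d ≤ 2 ^ d * ρ⁻¹ ^ d := by
        rw [← mul_pow]
        refine pow_le_pow_left₀ (inv_nonneg.2 (by linarith)) ?_ _
        refine (inv_anti₀ (by linarith) hD).trans (le_of_eq ?_)
        rw [inv_div]; rfl
      calc _ ≤ C₁ * (2 ^ d * ρ⁻¹ ^ d) * ∫ y, |m y| := by gcongr
        _ = _ := by ring
  obtain ⟨m', h3, h4, h5⟩ := h₂ _ _ A m hS ρ _ hρ (by positivity) hosc hb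
  refine ⟨m', h3, fun x hx => (h4 x hx).trans (le_of_eq (by ring)),
    fun x hx x' hx' => (h5 x hx x' hx').trans (le_of_eq (by ring))⟩

/-! ### Hölder seminorms and reduction to globally defined data -/

lemma abs_apply_le_frobenius_norm (M : Matrix (Fin d) (Fin d) ℝ) (i j : Fin d) :
    |M i j| ≤ ‖M‖ := by
  rw [Matrix.frobenius_norm_def, ← Real.sqrt_eq_rpow]
  refine Real.le_sqrt_of_sq_le ?_
  have h : |M i j| ^ 2 = ‖M i j‖ ^ (2 : ℝ) := by rw [Real.rpow_two, Real.norm_eq_abs]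
  rw [h]
  exact (Finset.single_le_sum (f := fun j => ‖M i j‖ ^ (2 : ℝ)) (fun j _ => by positivity)
    (Finset.mem_univ j)).trans (Finset.single_le_sum (f := fun i => ∑ j, ‖M i j‖ ^ (2 : ℝ))
    (fun i _ => Finset.sum_nonneg fun j _ => by positivity) (Finset.mem_univ i))

lemma norm_sub_le_of_holderSeminorm {E F : Type*} [NormedAddCommGroup E] [NormedAddCommGroup F]
    {α : ℝ} (hα : 0 < α) {U : Set E} {f : E → F} (h : holderSeminorm α U f ≠ ⊤) {x y : E}
    (hx : x ∈ U) (hy : y ∈ U) :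
    ‖f x - f y‖ ≤ (holderSeminorm α U f).toReal * ‖x - y‖ ^ α := by
  rcases eq_or_ne x y with rfl | hne
  · rw [sub_self, norm_zero]; positivity
  have h1 : ‖f x - f y‖ₑ / ‖x - y‖ₑ ^ α ≤ holderSeminorm α U f :=
    le_iSup₂_of_le (f := fun x _ => ⨆ y ∈ U, ⨆ _ : x ≠ y, ‖f x - f y‖ₑ / ‖x - y‖ₑ ^ α) x hx
      (le_iSup₂_of_le (f := fun y _ => ⨆ _ : x ≠ y, ‖f x - f y‖ₑ / ‖x - y‖ₑ ^ α) y hy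
        (le_iSup_of_le hne le_rfl))
  have hne0 : ‖x - y‖ₑ ≠ 0 := by simpa [sub_eq_zero] using hne
  have hp0 : ‖x - y‖ₑ ^ α ≠ 0 := by
    rw [Ne, ENNReal.rpow_eq_zero_iff]
    push Not
    exact ⟨fun h => absurd h hne0, fun h => absurd h (by simp)⟩
  have hpt : ‖x - y‖ₑ ^ α ≠ ⊤ := ENNReal.rpow_ne_top_of_nonneg hα.le (by simp)
  rw [ENNReal.div_le_iff hp0 hpt] at h1
  have h2 := ENNReal.toReal_mono (ENNReal.mul_ne_top h hpt) h1
  rwa [ENNReal.toReal_mul, ← ENNReal.toReal_rpow, toReal_enorm, toReal_enorm] at h2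

lemma holderSeminorm_le_ofReal {E : Type*} [NormedAddCommGroup E] {β : ℝ} {V : Set E} {f : E → ℝ}
    {c : ℝ} (hc : 0 ≤ c) (h : ∀ x ∈ V, ∀ y ∈ V, |f x - f y| ≤ c * ‖x - y‖ ^ β) :
    holderSeminorm β V f ≤ ENNReal.ofReal c := by
  refine iSup₂_le fun x hx => iSup₂_le fun y hy => iSup_le fun hne => ?_
  have hpos : 0 < ‖x - y‖ := norm_pos_iff.2 (sub_ne_zero.2 hne)
  refine ENNReal.div_le_of_le_mul ?_
  rw [← ofReal_norm, ← ofReal_norm, ENNReal.ofReal_rpow_of_pos hpos, ← ENNReal.ofReal_mul hc]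
  exact ENNReal.ofReal_le_ofReal (h x hx y hy)

/-- A weak solution coincides almost everywhere with an `AdjointSolution`. -/
lemma exists_adjointSolution {lam Lam α R : ℝ} (hα : 0 < α)
    {A : Euc d → Matrix (Fin d) (Fin d) ℝ} (hA : IsUniformlyElliptic lam Lam (ball 0 R) A)
    (hAα : holderSeminorm α (ball 0 R) A ≠ ⊤) {m : Euc d → ℝ} (hm : IntegrableOn m (ball 0 R))
    (hw : IsAdjointWeakSolution A (ball 0 R) m) :
    ∃ (A' : Euc d → Matrix (Fin d) (Fin d) ℝ) (m' : Euc d → ℝ),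
      AdjointSolution lam Lam (ball 0 R) A' m' ∧ (∀ x ∈ ball (0 : Euc d) R, A' x = A x) ∧
      m' =ᵐ[volume.restrict (ball 0 R)] m ∧
      ENNReal.ofReal (∫ y, |m' y|) = ∫⁻ y in ball 0 R, ‖m y‖ₑ := by
  set U : Set (Euc d) := ball 0 R with hU
  have hUm : MeasurableSet U := measurableSet_ball
  have hcont : ∀ i j, ContinuousOn (fun x => A x i j) U := by
    intro i j x hx
    rw [ContinuousWithinAt, tendsto_iff_norm_sub_tendsto_zero]
    have h1 : Tendsto (fun y => (holderSeminorm α U A).toReal * ‖y - x‖ ^ α) (𝓝[U] x) (𝓝 0) := by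
      have : ContinuousAt (fun y : Euc d => (holderSeminorm α U A).toReal * ‖y - x‖ ^ α) x :=
        continuousAt_const.mul ((continuousAt_id.sub continuousAt_const).norm.rpow_const
          (Or.inr hα.le))
      have h2 := this.tendsto
      simp only [sub_self, norm_zero, Real.zero_rpow hα.ne', mul_zero] at h2
      exact h2.mono_left nhdsWithin_le_nhds
    refine squeeze_zero' (Eventually.of_forall fun _ => norm_nonneg _) ?_ h1
    filter_upwards [self_mem_nhdsWithin] with y hy
    exact (abs_apply_le_frobenius_norm (A y - A x) i j).trans
      (norm_sub_le_of_holderSeminorm hα hAα hy hx)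
  set m₁ : Euc d → ℝ := hm.aestronglyMeasurable.mk m with hm₁
  have hm₁m : m =ᵐ[volume.restrict U] m₁ := hm.aestronglyMeasurable.ae_eq_mk
  have hm₁s : Measurable m₁ := hm.aestronglyMeasurable.stronglyMeasurable_mk.measurable
  have hA' : ∀ x ∈ U, U.indicator A x = A x := fun x hx => indicator_of_mem hx A
  have hae : U.indicator m₁ =ᵐ[volume.restrict U] m := by
    filter_upwards [hm₁m, ae_restrict_mem hUm] with x hx hxU
    rw [indicator_of_mem hxU, hx]
  have hint : Integrable (U.indicator m₁) :=
    (integrable_indicator_iff hUm).2 (IntegrableOn.congr_fun_ae hm hm₁m)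
  -- Coefficients and a measurable representative of `m` are extended by zero, so that measurability
  -- and integrability hold on the whole space and all integrals can be taken there.
  refine ⟨U.indicator A, U.indicator m₁, ⟨fun x hx => ?_, fun i j => ?_, hm₁s.indicator hUm, hint,
    fun x hx => indicator_of_notMem hx _, fun φ hφ hφc hφU => ?_⟩, hA', hae, ?_⟩
  · rw [hA' x hx]
    exact hA x hx
  · classical
    have h := (hcont i j).measurable_piecewise (g := fun _ => (0 : ℝ)) continuousOn_const hUm
    convert h using 1
    ext x
    by_cases hx : x ∈ U <;> simp [hx]
  · have h := neg_eq_zero.1 (hw.2 φ hφ hφc hφU)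
    rw [← setIntegral_eq_integral_of_forall_compl_eq_zero (s := U), ← h]
    · refine integral_congr_ae ?_
      filter_upwards [hae, ae_restrict_mem hUm] with x hx hxU
      rw [hx, hA' x hxU, mul_comm]
    · intro x hx
      rw [indicator_of_notMem hx, zero_mul]
  · simp only [← Real.norm_eq_abs]
    rw [ofReal_integral_norm_eq_lintegral_enorm hint,
      ← setLIntegral_eq_of_support_subset (s := U)]
    · refine lintegral_congr_ae ?_
      filter_upwards [hae] with x hx
      rw [hx]
    · intro x hx
      by_contra hxU
      exact hx (by simp [hxU])

end

/-! ### Choice of the scale and conclusion -/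

theorem propositionA3 (d : ℕ) (hd : 2 ≤ d) (lam Lam : ℝ) (hlam : 0 < lam) (hLam : lam ≤ Lam)
    (α : ℝ) (hα0 : 0 < α) (hα1 : α ≤ 1)
    (β : ℝ) (hβ0 : 0 < β) (hβα : β ≤ α) (hβ1 : β < 1) :
    ∃ C : ℝ, 1 ≤ C ∧
      ∀ (r : ℝ), 0 < r →
      ∀ (A : Euc d → Matrix (Fin d) (Fin d) ℝ),
        IsUniformlyElliptic lam Lam (Metric.ball 0 (2 * r)) A →
        MemHolderSpace α (Metric.ball 0 (2 * r)) A →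
      ∀ (m : Euc d → ℝ),
        IntegrableOn m (Metric.ball 0 (2 * r)) volume →
        IsAdjointWeakSolution A (Metric.ball 0 (2 * r)) m →
        ∃ m' : Euc d → ℝ,
          m' =ᵐ[volume.restrict (Metric.ball 0 r)] m ∧
          MemHolderSpace β (Metric.ball 0 r) m' ∧
          eLpNorm m' ⊤ (volume.restrict (Metric.ball 0 r))
              + ENNReal.ofReal (r ^ β) * holderSeminorm β (Metric.ball 0 r) m'
            ≤ ENNReal.ofReal C
              * (1 + ENNReal.ofReal (r ^ α) * holderSeminorm α (Metric.ball 0 (2 * r)) A)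
                  ^ (((d : ℝ) + β) / α)
              * ⨍⁻ x in Metric.ball 0 (2 * r), ‖m x‖ₑ ∂volume := by
  have hLam0 : 0 < Lam := hlam.trans_le hLam
  obtain ⟨ε, hε, C₀, hC₀, hmain⟩ := exists_interior_estimate d hlam hLam0 hβ0 hβ1
  set ω : ℝ := volume.real (ball (0 : Euc d) 1) with hω
  obtain ⟨δ, hδ0, hδ1, hδε⟩ : ∃ δ : ℝ, 0 < δ ∧ δ ≤ 1 ∧ δ ≤ ε :=
    ⟨min ε 1, lt_min hε one_pos, min_le_right _ _, min_le_left _ _⟩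
  set q : ℝ := ((d : ℝ) + β) / α with hq
  have hq0 : 0 ≤ q := by positivity
  -- The `2` comes from `1 + (r / ρ)^β ≤ 2 (r / ρ)^β`, and `2 ^ d * ω` is the volume of the ball of
  -- radius `2 r` divided by `r ^ d`, which turns the integral into an average.
  refine ⟨max 1 (2 * C₀ * δ⁻¹ ^ q * (2 ^ d * ω)), le_max_left _ _, fun r hr A hA hAα m hm hw => ?_⟩
  obtain ⟨A', m₀, hS, hAA', hm₀, hm₀I⟩ := exists_adjointSolution hα0 hA hAα.2.ne hm hw
  set a : ℝ := (holderSeminorm α (ball 0 (2 * r)) A).toReal with ha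
  have ha0 : 0 ≤ a := ENNReal.toReal_nonneg
  set X : ℝ := 1 + r ^ α * a with hX
  have hX1 : 1 ≤ X := le_add_of_nonneg_right (by positivity)
  have hX0 : 0 < X := by linarith
  -- Chosen so that `ρ^α = r^α δ / X`, hence `a ρ^α ≤ δ ≤ ε`; `δ ≤ 1 ≤ X` ensures `ρ ≤ r`.
  set ρ : ℝ := r * (δ / X) ^ α⁻¹ with hρ
  have hδX : 0 < δ / X := by positivity
  have hδX1 : δ / X ≤ 1 := (div_le_one hX0).2 (hδ1.trans hX1)
  have hρ0 : 0 < ρ := by positivity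
  have hρr : ρ ≤ r := mul_le_of_le_one_right hr.le
    (Real.rpow_le_one hδX.le hδX1 (inv_nonneg.2 hα0.le))
  have hρα : a * ρ ^ α ≤ ε := by
    rw [hρ, Real.mul_rpow hr.le (by positivity), Real.rpow_inv_rpow hδX.le hα0.ne']
    have h1 : a * r ^ α ≤ X := by rw [hX]; linarith [mul_comm a (r ^ α)]
    calc a * (r ^ α * (δ / X)) = (a * r ^ α) * (δ / X) := by ring
      _ ≤ X * (δ / X) := mul_le_mul_of_nonneg_right h1 hδX.le
      _ = δ := mul_div_cancel₀ _ hX0.ne'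
      _ ≤ ε := hδε
  have hosc : OscBound β ρ ε (ball 0 (2 * r)) A' := by
    intro x hx y hy hxy i j
    rw [hAA' x hx, hAA' y hy]
    refine (abs_apply_le_frobenius_norm (A x - A y) i j).trans
      ((norm_sub_le_of_holderSeminorm hα0 hAα.2.ne hx hy).trans ?_)
    rw [← dist_eq_norm, ← ha]
    have h1 : dist x y ^ α = ρ ^ α * (dist x y / ρ) ^ α := by
      rw [← Real.mul_rpow hρ0.le (by positivity), mul_div_cancel₀ _ hρ0.ne']
    rw [h1, ← mul_assoc]
    refine mul_le_mul hρα ?_ (by positivity) hε.le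
    -- Below distance `ρ` the ratio is at most `1`, so lowering the exponent from `α` to `β` only
    -- increases the bound.
    exact Real.rpow_le_rpow_of_exponent_ge' (by positivity) ((div_le_one hρ0).2 hxy) hβ0.le hβα
  obtain ⟨m', hm', hsup, hhol⟩ := hmain r ρ hρ0 hρr A' m₀ hS hosc
  set I : ℝ := ∫ y, |m₀ y| with hI
  have hI0 : 0 ≤ I := integral_nonneg fun _ => abs_nonneg _
  set S : ℝ := C₀ * (ρ⁻¹ ^ d * I) with hSdef
  have hS0 : 0 ≤ S := by positivity
  have hsub : ball (0 : Euc d) r ⊆ ball 0 (2 * r) := ball_subset_ball (by linarith)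
  have hsemi : holderSeminorm β (ball 0 r) m' ≤ ENNReal.ofReal (S * (ρ ^ β)⁻¹) := by
    refine holderSeminorm_le_ofReal (by positivity) fun x hx y hy => (hhol x hx y hy).trans ?_
    rw [Real.div_rpow dist_nonneg hρ0.le, dist_eq_norm]
    exact le_of_eq (by ring)
  refine ⟨m', ?_, ⟨lt_of_le_of_lt (iSup₂_le fun x hx => ?_) (ENNReal.ofReal_lt_top (r := S)),
    hsemi.trans_lt ENNReal.ofReal_lt_top⟩, ?_⟩
  · filter_upwards [ae_restrict_of_ae hm', ae_restrict_of_ae_restrict_of_subset hsub hm₀,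
      ae_restrict_mem measurableSet_ball] with x h1 h2 h3
    rw [h1 h3, h2]
  · rw [← ofReal_norm]
    exact ENNReal.ofReal_le_ofReal (hsup x hx)
  have hLinf : eLpNorm m' ⊤ (volume.restrict (ball 0 r)) ≤ ENNReal.ofReal S := by
    rw [eLpNorm_exponent_top]
    refine eLpNormEssSup_le_of_ae_bound ?_
    filter_upwards [ae_restrict_mem measurableSet_ball] with x hx
    exact hsup x hx
  -- Since `r / ρ = (X / δ)^(1/α)`, this power is where the exponent `(d + β) / α` of the theorem
  -- arises: `d` from the `L¹` mean at scale `ρ`, `β` from the seminorm at scale `ρ`.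
  have hratio : (r / ρ) ^ (d + β) = δ⁻¹ ^ q * X ^ q := by
    rw [← Real.mul_rpow (by positivity) hX0.le, hρ, hq, div_mul_eq_div_div, div_self hr.ne',
      one_div, ← Real.inv_rpow hδX.le, ← Real.rpow_mul (by positivity), inv_div, div_eq_inv_mul X δ,
      div_eq_inv_mul _ α]
  have h1r : 1 ≤ r / ρ := (one_le_div hρ0).2 hρr
  have hsum : S + r ^ β * (S * (ρ ^ β)⁻¹)
      ≤ (2 * C₀ * δ⁻¹ ^ q) * X ^ q * ((r ^ d)⁻¹ * I) := by
    have h1 : S + r ^ β * (S * (ρ ^ β)⁻¹) = S * (1 + (r / ρ) ^ β) := by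
      rw [Real.div_rpow hr.le hρ0.le]; ring
    have h2 : 1 + (r / ρ) ^ β ≤ 2 * (r / ρ) ^ β := by
      linarith [Real.one_le_rpow h1r hβ0.le]
    have h3 : S * (2 * (r / ρ) ^ β) = 2 * C₀ * ((r / ρ) ^ (d + β)) * ((r ^ d)⁻¹ * I) := by
      rw [Real.rpow_add (by positivity), Real.rpow_natCast, hSdef, div_pow, inv_pow]
      field_simp
    rw [h1]
    refine (mul_le_mul_of_nonneg_left h2 hS0).trans (le_of_eq ?_)
    rw [h3, hratio]
    ring
  have hvol : volume (ball (0 : Euc d) (2 * r)) = ENNReal.ofReal (2 ^ d * ω * r ^ d) := by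
    rw [Measure.addHaar_ball_of_pos volume _ (by positivity), finrank_euclideanSpace_fin, hω,
      mul_right_comm, ← mul_pow, ENNReal.ofReal_mul (by positivity), measureReal_def,
      ENNReal.ofReal_toReal measure_ball_lt_top.ne]
  have hω0 : 0 < ω := ENNReal.toReal_pos
    (measure_ball_pos volume (0 : Euc d) one_pos).ne' measure_ball_lt_top.ne
  have havg : ENNReal.ofReal ((r ^ d)⁻¹ * I)
      = ENNReal.ofReal (2 ^ d * ω) * ⨍⁻ x in ball 0 (2 * r), ‖m x‖ₑ ∂volume := by
    rw [setLAverage_eq, hvol, ← hm₀I, ← ENNReal.ofReal_div_of_pos (by positivity),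
      ← ENNReal.ofReal_mul (by positivity)]
    congr 1
    field_simp
  have hXe : ENNReal.ofReal (X ^ q)
      = (1 + ENNReal.ofReal (r ^ α) * holderSeminorm α (ball 0 (2 * r)) A) ^ q := by
    rw [← ENNReal.ofReal_rpow_of_nonneg hX0.le hq0, hX, ENNReal.ofReal_add zero_le_one
      (by positivity), ENNReal.ofReal_one, ENNReal.ofReal_mul (by positivity), ha,
      ENNReal.ofReal_toReal hAα.2.ne]
  calc eLpNorm m' ⊤ (volume.restrict (ball 0 r))
        + ENNReal.ofReal (r ^ β) * holderSeminorm β (ball 0 r) m'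
      ≤ ENNReal.ofReal S + ENNReal.ofReal (r ^ β) * ENNReal.ofReal (S * (ρ ^ β)⁻¹) :=
        add_le_add hLinf (mul_le_mul_right hsemi _)
    _ = ENNReal.ofReal (S + r ^ β * (S * (ρ ^ β)⁻¹)) := by
        rw [← ENNReal.ofReal_mul (by positivity), ← ENNReal.ofReal_add hS0 (by positivity)]
    _ ≤ ENNReal.ofReal ((2 * C₀ * δ⁻¹ ^ q) * X ^ q * ((r ^ d)⁻¹ * I)) :=
        ENNReal.ofReal_le_ofReal hsum
    _ = ENNReal.ofReal (2 * C₀ * δ⁻¹ ^ q * (2 ^ d * ω)) * ENNReal.ofReal (X ^ q)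
          * ⨍⁻ x in ball 0 (2 * r), ‖m x‖ₑ ∂volume := by
        rw [ENNReal.ofReal_mul (by positivity), havg, ENNReal.ofReal_mul (by positivity),
          ENNReal.ofReal_mul (p := 2 * C₀ * δ⁻¹ ^ q) (by positivity)]
        ring
    _ ≤ _ := by
        rw [hXe]
        gcongr
        exact le_max_right _ _
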